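/- **Setting.** A coin-flipping protocol consists of a finite sequence of quantum messages (each a finite-dimensional register with a prescribed sender, Alice or Bob) and of two honest players. A player has a finite-dimensional private memory in some initial state (the joint initial state is a product state), produces each of its own messages by a quantum channel applied to its memory, absorbs each message of the opponent by a quantum channel, and at the end outputs a bit by a two-outcome projective measurement; output $0$ means that Alice wins and $1$ that Bob wins. The protocol is *fair* if, when both players are honest, their outputs always agree and are uniformly random. $P_A^*$ is the supremum, over all (arbitrary) behaviours of Alice, of the probability that honest Bob outputs $0$; $P_B^*$ is the supremum, over all behaviours of Bob, of the probability that honest Alice outputs $1$. The *bias* is $\epsilon=\max(P_A^*,P_B^*)-\tfrac12$. **The family.** Let $n\ge 2$ and $a_1,\dots,a_n\in[0,1]$, and let $|\phi_i\rangle=\sqrt{a_i}\,|00\rangle+\sqrt{1-a_i}\,|11\rangle$. In the protocol $\mathcal P_n(a_1,\dots,a_n)$ Alice prepares $|\phi_i\rangle$ for odd $i$, Bob for even $i$. For $i=1,\dots,n$, message $i$ consists of one half of $|\phi_i\rangle$, sent by its owner; honest players then share $|\psi\rangle=\bigotimes_i(\sqrt{a_i}|0\rangle_A|0\rangle_B+\sqrt{1-a_i}|1\rangle_A|1\rangle_B)$.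 Let $E_0,E_1$ be the complementary diagonal projectors on $n$ qubits for the following rule: a basis state is read from qubit $n$ down to qubit $1$, and the sender of the first qubit found to be $0$ loses; if all qubits are $1$, Alice wins ($E_0$: Alice wins, $E_1$: Bob wins). Each player measures $\{E_0,E_1\}$ on its $n$ qubits. In message $n+1$ Alice sends all her qubits if she obtained $E_0$ (and outputs $0$), and nothing otherwise; in message $n+2$ Bob sends all his qubits if he obtained $E_1$ (and outputs $1$), and nothing otherwise. If Alice obtained $E_1$ and received $n$ qubits, she measures $\{F_1,I-F_1\}$ on her qubits and those received and outputs $1$ on $F_1$; otherwise she outputs $0$. If Bob obtained $E_0$ and received $n$ qubits, he measures $\{F_0,I-F_0\}$ and outputs $0$ on $F_0$; otherwise he outputs $1$. Here $F_w$ is the orthogonal projection onto the line of $(E_w\otimes E_w)|\psi\rangle$. **The bounds.** For a diagonal matrix let $\mathrm{Tr}_{a_i}$ and $\mathrm{RMS}_{a_i}$ replace each pair of diagonal entries $d_0,d_1$ whose basis states differ only in qubit $i$ (being $0$, respectively $1$, there) by $a_id_0+(1-a_i)d_1$, respectively $\sqrt{a_id_0^2+(1-a_i)d_1^2}$. Put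 $$\alpha=2\left(\mathrm{RMS}_{a_1}\mathrm{Tr}_{a_2}\mathrm{RMS}_{a_3}\mathrm{Tr}_{a_4}\cdots E_0\right)^2,\qquad \beta=2\left(\mathrm{Tr}_{a_1}\mathrm{RMS}_{a_2}\mathrm{Tr}_{a_3}\mathrm{RMS}_{a_4}\cdots E_1\right)^2,$$ where the operations alternate and there is one for each of the $n$ qubits. **Theorem.** There exists a fair quantum coin-flipping protocol with bias strictly less than $1/\sqrt2-1/2$. More precisely, in each of the following cases there are parameters $a_1,\dots,a_n\in[0,1]$ for which $\mathcal P_n(a_1,\dots,a_n)$ is exactly fair, has $n+2$ messages, and satisfies $P_A^*\le\alpha$ and $P_B^*\le\beta$, with the following values. 1. $n=3$ ($5$ messages), each $a_i$ within $10^{-6}$ of $(0.74094,\ 0.479696,\ 0.186312)$: $|\alpha-0.69905|\le 5\cdot10^{-6}$, $|\beta-0.69905|\le 5\cdot 10^{-6}$, and the bias is at most $0.1991$. 2. $n=8$, each $a_i$ within $10^{-6}$ of $(0.680706,\ 0.43281,\ 0.323787,\ 0.264123,\ 0.224377,\ 0.197997,\ 0.177191,\ 0.0834815)$: $|\max(\alpha,\beta)-\tfrac12-0.1931|\le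 5\cdot10^{-5}$; in particular the bias is at most $0.19315$. 3. $n=4$, $n=6$, $n=10$: $|\max(\alpha,\beta)-\tfrac12-\epsilon_n|\le5\cdot10^{-5}$ with $\epsilon_4=0.1957$, $\epsilon_6=0.1937$, $\epsilon_{10}=0.1927$; in particular the bias is at most $\epsilon_n+5\cdot10^{-5}$. -/

import Mathlib

open scoped Matrix Kronecker ComplexOrder

noncomputable section

namespace CoinFlip

/-! ### Two-party quantum protocols -/

/-- The two players. A player's name also serves as an outcome of the coin flip: `alice` is the
outcome zero (Alice wins) and `bob` is the outcome one (Bob wins). -/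
inductive Player
  | alice
  | bob
  deriving DecidableEq

instance : Fintype Player where
  elems := {.alice, .bob}
  complete w := by cases w <;> simp

/-- The opponent. -/
def Player.other : Player → Player
  | .alice => .bob
  | .bob => .alice

/-- A finite-dimensional quantum register, given by the labels of its computational basis. -/
structure Register where
  carrier : Type
  [fintype : Fintype carrier]
  [decEq : DecidableEq carrier]

instance : CoeSort Register Type := ⟨Register.carrier⟩

instance (α : Register) : Fintype α := α.fintype

instance (α : Register) : DecidableEq α := α.decEq

/-- A quantum channel (completely positive trace-preserving map), in Kraus form. -/
structure Channel (α β : Type) [Fintype α] [DecidableEq α] [Fintype β] where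
  ι : Type
  [fintype : Fintype ι]
  kraus : ι → Matrix β α ℂ
  complete : ∑ k, (kraus k)ᴴ * kraus k = 1

section Channel

variable {α β γ : Type} [Fintype α] [DecidableEq α] [Fintype β] [Fintype γ] [DecidableEq γ]

/-- The action of a channel on the left half of a bipartite state. -/
def Channel.onLeft (C : Channel α β) (ρ : Matrix (α × γ) (α × γ) ℂ) :
    Matrix (β × γ) (β × γ) ℂ :=
  letI := C.fintype
  ∑ k, (C.kraus k ⊗ₖ (1 : Matrix γ γ ℂ)) * ρ * (C.kraus k ⊗ₖ (1 : Matrix γ γ ℂ))ᴴ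

/-- The action of a channel on the right half of a bipartite state. -/
def Channel.onRight (C : Channel α β) (ρ : Matrix (γ × α) (γ × α) ℂ) :
    Matrix (γ × β) (γ × β) ℂ :=
  letI := C.fintype
  ∑ k, ((1 : Matrix γ γ ℂ) ⊗ₖ C.kraus k) * ρ * ((1 : Matrix γ γ ℂ) ⊗ₖ C.kraus k)ᴴ

/-- Measure the value of `o` in the computational basis, then apply `|x⟩ ↦ |f x⟩`.
(If `o` is constant, no measurement takes place and the channel is an isometry.) -/
def Channel.measureMap [DecidableEq β] {ω : Type} [Fintype ω] [DecidableEq ω]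
    (o : α → ω) (f : α → β) (hf : ∀ x x', o x = o x' → f x = f x' → x = x') : Channel α β where
  ι := ω
  kraus w := Matrix.of fun y x => if o x = w ∧ y = f x then 1 else 0
  complete := by
    ext x x'
    simp only [Matrix.sum_apply, Matrix.mul_apply, Matrix.conjTranspose_apply, Matrix.of_apply,
      Matrix.one_apply]
    by_cases h : x = x'
    · subst h
      simp [ite_and]
    · rw [if_neg h]
      refine Finset.sum_eq_zero fun w _ => Finset.sum_eq_zero fun y _ => ?_
      by_cases h1 : o x = w ∧ y = f x
      · by_cases h2 : o x' = w ∧ y = f x'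
        · exact absurd (hf x x' (h1.1.trans h2.1.symm) (h1.2.symm.trans h2.2)) h
        · simp [h2]
      · simp [h1]

/-- The isometry `|x⟩ ↦ |f x⟩` of an injective relabelling. -/
def Channel.ofInjective [DecidableEq β] (f : α → β) (hf : Function.Injective f) : Channel α β :=
  Channel.measureMap (fun _ => ()) f fun _ _ _ h => hf h

end Channel

/-- A two-outcome projective measurement, the outcome being the declared winner. -/
structure Measurement (α : Type) [Fintype α] [DecidableEq α] where
  proj : Player → Matrix α α ℂ
  hermitian : ∀ w, (proj w).IsHermitian
  idempotent : ∀ w, proj w * proj w = proj w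
  complete : proj .alice + proj .bob = 1

/-- A message: who sends it, and the register that carries it. -/
structure Message where
  sender : Player
  register : Register

/-- What a player `me` does, from some point of the protocol on, when the messages in the list are
still to be exchanged and the private memory is the second index. A message of `me` is produced by
a channel from the memory to the new memory and the message; a message of the opponent is absorbed
by a channel from the memory and the message to the new memory; after the last message the output
is obtained by a measurement of the memory. -/
inductive Strategy (me : Player) : List Message → Register → Type 1
  | measure {α : Register} (M : Measurement α) : Strategy me [] α
  | send {s : Player} {m : Register} {l : List Message} {α α' : Register} (h : s = me)
      (C : Channel α (α' × m)) (next : Strategy me l α') : Strategy me (⟨s, m⟩ :: l) α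
  | recv {s : Player} {m : Register} {l : List Message} {α α' : Register} (h : s ≠ me)
      (C : Channel (α × m) α') (next : Strategy me l α') : Strategy me (⟨s, m⟩ :: l) α

/-- Handing a message register over from the left player to the right player. -/
def passRight {α β m : Type} (ρ : Matrix ((α × m) × β) ((α × m) × β) ℂ) :
    Matrix (α × (β × m)) (α × (β × m)) ℂ :=
  ρ.submatrix (fun p => ((p.1, p.2.2), p.2.1)) (fun p => ((p.1, p.2.2), p.2.1))

/-- Handing a message register over from the right player to the left player. -/
def passLeft {α β m : Type} (ρ : Matrix (α × (β × m)) (α × (β × m)) ℂ) :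
    Matrix ((α × m) × β) ((α × m) × β) ℂ :=
  ρ.submatrix (fun p => (p.1.1, (p.2, p.1.2))) (fun p => (p.1.1, (p.2, p.1.2)))

/-- The probability that Alice outputs `x` and Bob outputs `y`, when their memories start in the
joint state `ρ` and they follow the given strategies. -/
def run : (l : List Message) → {α β : Register} → Strategy .alice l α → Strategy .bob l β →
    Matrix (α × β) (α × β) ℂ → Player → Player → ℝ
  | [], _, _, .measure M, .measure N, ρ, x, y => ((M.proj x ⊗ₖ N.proj y) * ρ).trace.re
  | _ :: l, _, _, .send _ C A, .recv _ D B, ρ, x, y =>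
      run l A B (D.onRight (passRight (C.onLeft ρ))) x y
  | _ :: l, _, _, .recv _ C A, .send _ D B, ρ, x, y =>
      run l A B (C.onLeft (passLeft (D.onRight ρ))) x y
  | _ :: _, _, _, .send h _ _, .send h' _ _, _, _, _ => nomatch h.symm.trans h'
  | _ :: _, _, _, .recv (s := .alice) h _ _, .recv _ _ _, _, _, _ => absurd rfl h
  | _ :: _, _, _, .recv (s := .bob) _ _ _, .recv h' _ _, _, _, _ => absurd rfl h'

/-- A player together with a private memory, its initial state, and a strategy for the given
sequence of messages. Since a message register is part of the rules, but the memory and all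
operations are arbitrary, these are exactly the possible behaviours of a cheating player. -/
structure Agent (me : Player) (l : List Message) where
  memory : Register
  init : Matrix memory memory ℂ
  posSemidef : init.PosSemidef
  trace_eq_one : init.trace = 1
  strategy : Strategy me l memory

/-- The joint distribution of the outputs; the initial state is unentangled. -/
def outcomeProb {l : List Message} (A : Agent .alice l) (B : Agent .bob l) (x y : Player) : ℝ :=
  run l A.strategy B.strategy (A.init ⊗ₖ B.init) x y

/-- A coin-flipping protocol: the sequence of messages and the honest players. -/
structure Protocol where
  messages : List Message
  alice : Agent .alice messages
  bob : Agent .bob messages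

namespace Protocol

variable (P : Protocol)

/-- When both players are honest, they output the same bit, and it is uniformly random. -/
def IsFair : Prop :=
  ∀ x y, outcomeProb P.alice P.bob x y = if x = y then 1 / 2 else 0

/-- `P_A^*`: the supremum, over everything Alice may do, of the probability that honest Bob
outputs that Alice wins. -/
def cheatAlice : ℝ :=
  sSup {p | ∃ A : Agent .alice P.messages, p = ∑ x, outcomeProb A P.bob x .alice}

/-- `P_B^*`: the supremum, over everything Bob may do, of the probability that honest Alice
outputs that Bob wins. -/
def cheatBob : ℝ :=
  sSup {p | ∃ B : Agent .bob P.messages, p = ∑ y, outcomeProb P.alice B .bob y}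

/-- The bias `max (P_A^*, P_B^*) - 1 / 2`. -/
def bias : ℝ := max P.cheatAlice P.cheatBob - 1 / 2

end Protocol

/-! ### The family of protocols

The parameters are `a 1, …, a n`; bit strings `x : Fin n → Fin 2` have `x i` for the qubit of
message `i + 1`. -/

/-- One qubit. -/
abbrev qubit : Register := ⟨Fin 2⟩

/-- `k` qubits. -/
abbrev qubits (k : ℕ) : Register := ⟨Fin k → Fin 2⟩

/-- Either `k` qubits, or nothing. -/
abbrev qubitsOrNothing (k : ℕ) : Register := ⟨Option (Fin k → Fin 2)⟩

/-- The sender of message `i`. -/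
def sender (i : ℕ) : Player := if Odd i then .alice else .bob

/-- The amplitudes of `√a |00⟩ + √(1 - a) |11⟩`. -/
def phi (a : unitInterval) (p : Fin 2 × Fin 2) : ℂ :=
  if p = (0, 0) then (√(a : ℝ) : ℝ) else if p = (1, 1) then (√(1 - (a : ℝ)) : ℝ) else 0

/-- The amplitudes of the state `ψ` that the honest players share after the first `n` messages. -/
def psi (a : ℕ → unitInterval) (n : ℕ) (p : qubits n × qubits n) : ℂ :=
  ∏ i : Fin n, phi (a (i + 1)) (p.1 i, p.2 i)

/-- The outcome of `{E_0, E_1}` on a basis state: the qubits are examined from the last to the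
first, and the sender of the first one found to be zero loses; if all are one, Alice wins. -/
def winner : (n : ℕ) → (Fin n → Fin 2) → Player
  | 0, _ => .alice
  | n + 1, x => if x (Fin.last n) = 0 then (sender (n + 1)).other else winner n (Fin.init x)

/-- The diagonal of the projector `E_w` onto the basis states with winner `w`. -/
def E (w : Player) (n : ℕ) (x : Fin n → Fin 2) : ℝ := if winner n x = w then 1 else 0

/-- The vector `(E_w ⊗ E_w) ψ`. -/
def checkVec (a : ℕ → unitInterval) (w : Player) (n : ℕ) (p : qubits n × qubits n) : ℂ :=
  E w n p.1 * E w n p.2 * psi a n p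

/-- The same vector on the memory of a player who checks the opponent: the first component holds
the player's own qubits (`none` if they were sent away), the second the opponent's message. -/
def checkVecMem (a : ℕ → unitInterval) (w : Player) (n : ℕ) :
    qubitsOrNothing n × qubitsOrNothing n → ℂ
  | (some x, some y) => checkVec a w n (x, y)
  | _ => 0

/-- The orthogonal projection `|v⟩⟨v| / ⟨v|v⟩` onto the line of a vector. -/
def lineProj {α : Type} [Fintype α] (v : α → ℂ) : Matrix α α ℂ :=
  (v ⬝ᵥ star v)⁻¹ • Matrix.vecMulVec v (star v)

theorem lineProj_isHermitian {α : Type} [Fintype α] (v : α → ℂ) : (lineProj v).IsHermitian := by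
  have h : star (v ⬝ᵥ star v) = v ⬝ᵥ star v := (Matrix.dotProduct_star v v).symm
  ext i j
  simp only [lineProj, Matrix.conjTranspose_apply, Matrix.smul_apply, Matrix.vecMulVec_apply,
    smul_eq_mul, star_mul', star_inv₀, h, Pi.star_apply, star_star]
  ring

theorem lineProj_idempotent {α : Type} [Fintype α] (v : α → ℂ) :
    lineProj v * lineProj v = lineProj v := by
  rw [lineProj, Matrix.smul_mul, Matrix.mul_smul, Matrix.vecMulVec_mul_vecMulVec,
    dotProduct_comm (star v) v]
  by_cases h : v ⬝ᵥ star v = 0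
  · simp [h]
  · rw [Matrix.vecMulVec_smul, smul_smul, smul_smul, mul_assoc,
      inv_mul_cancel₀ h, mul_one]

/-- The final measurement of a player whose opponent is `w`. The outcome is `w` exactly if the
player still has its own qubits (so that `{E_0, E_1}` gave `w`), has received the `n` qubits of
`w`, and finds them in the state `(E_w ⊗ E_w) ψ`, normalized. In all other cases the player
declares itself the winner. -/
def finalMeasurement (a : ℕ → unitInterval) (w : Player) (n : ℕ) :
    Measurement (qubitsOrNothing n × qubitsOrNothing n) where
  proj w' := if w' = w then lineProj (checkVecMem a w n) else 1 - lineProj (checkVecMem a w n)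
  hermitian w' := by
    split_ifs
    · exact lineProj_isHermitian _
    · exact Matrix.isHermitian_one.sub (lineProj_isHermitian _)
  idempotent w' := by
    split_ifs
    · exact lineProj_idempotent _
    · simp [sub_mul, mul_sub, lineProj_idempotent]
  complete := by
    cases w <;> simp

/-- The messages that remain after `k` qubits were sent, when `j` more are to be sent, first by `p`,
then by `q`, and so on in turn; then come the two messages of the cheat detection. -/
def messagesFrom (p q : Player) (k : ℕ) : ℕ → List Message
  | 0 => [⟨.alice, qubitsOrNothing k⟩, ⟨.bob, qubitsOrNothing k⟩]
  | j + 1 => ⟨p, qubit⟩ :: messagesFrom q p (k + 1) j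

/-- The register of the pairs of qubits that a player has prepared and not yet used, when `j`
qubits are still to be sent; the flag tells whether the next one is sent by this player. -/
def unsent : ℕ → Bool → Register
  | 0, _ => ⟨Unit⟩
  | j + 1, true => ⟨(Fin 2 × Fin 2) × unsent j false⟩
  | j + 1, false => unsent j true

/-- The amplitudes of `φ_i ⊗ φ_{i+2} ⊗ ⋯` on that register, `k` qubits having been sent. -/
def unsentState (a : ℕ → unitInterval) : (j : ℕ) → (mine : Bool) → (k : ℕ) → unsent j mine → ℂ
  | 0, _, _, _ => 1
  | j + 1, true, k, u => phi (a (k + 1)) u.1 * unsentState a j false (k + 1) u.2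
  | j + 1, false, k, u => unsentState a j true (k + 1) u

theorem phi_norm (a : unitInterval) : ∑ p, phi a p * star (phi a p) = 1 := by
  have h0 : (0 : ℝ) ≤ a := a.2.1
  have h1 : (0 : ℝ) ≤ 1 - a := sub_nonneg.2 a.2.2
  simp only [phi, Fintype.sum_prod_type, Fin.sum_univ_two]
  simp [← Complex.ofReal_mul, Real.mul_self_sqrt h0, Real.mul_self_sqrt h1]

theorem unsentState_norm (a : ℕ → unitInterval) : ∀ (j : ℕ) (mine : Bool) (k : ℕ),
    ∑ u, unsentState a j mine k u * star (unsentState a j mine k u) = 1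
  | 0, _, _ => by
    change ∑ u : Unit, (1 : ℂ) * star 1 = 1
    simp
  | j + 1, false, k => unsentState_norm a j true (k + 1)
  | j + 1, true, k => by
    change ∑ u : (Fin 2 × Fin 2) × unsent j false,
      (phi (a (k + 1)) u.1 * unsentState a j false (k + 1) u.2) *
        star (phi (a (k + 1)) u.1 * unsentState a j false (k + 1) u.2) = 1
    rw [Fintype.sum_prod_type]
    calc _ = ∑ p, ∑ u, (phi (a (k + 1)) p * star (phi (a (k + 1)) p)) *
          (unsentState a j false (k + 1) u * star (unsentState a j false (k + 1) u)) := by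
          refine Finset.sum_congr rfl fun p _ => Finset.sum_congr rfl fun u _ => ?_
          rw [star_mul']
          ring
      _ = 1 := by
          rw [← Finset.sum_mul_sum, phi_norm, unsentState_norm a j false (k + 1), one_mul]

/-- The memory during the first `n` messages: the halves that are kept or were received, one for
each of the `k` messages so far, and the pairs that are not yet used. -/
abbrev stage (k j : ℕ) (mine : Bool) : Register := ⟨qubits k × unsent j mine⟩

/-- The first `n` messages: send one half of the next prepared pair and keep the other one, or
receive a qubit. -/
def exchange {me opp : Player} (h : opp ≠ me)
    (finish : ∀ (k : ℕ) (mine : Bool), Strategy me (messagesFrom .alice .bob k 0) (stage k 0 mine)) :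
    (j k : ℕ) → (mine : Bool) →
      Strategy me (messagesFrom (cond mine me opp) (cond mine opp me) k j) (stage k j mine)
  | 0, k, mine => finish k mine
  | j + 1, k, true =>
      .send rfl
        (Channel.ofInjective
          (fun p : qubits k × ((Fin 2 × Fin 2) × unsent j false) =>
            (((Fin.snoc p.1 p.2.1.1 : Fin (k + 1) → Fin 2), p.2.2), p.2.1.2))
          (by
            rintro ⟨x, ⟨b, c⟩, u⟩ ⟨x', ⟨b', c'⟩, u'⟩ hx
            simp only [Prod.mk.injEq, Fin.snoc_inj] at hx
            obtain ⟨⟨⟨rfl, rfl⟩, rfl⟩, rfl⟩ := hx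
            rfl))
        (exchange h finish j (k + 1) false)
  | j + 1, k, false =>
      .recv h
        (Channel.ofInjective
          (fun p : (qubits k × unsent j true) × qubit =>
            ((Fin.snoc p.1.1 p.2 : Fin (k + 1) → Fin 2), p.1.2))
          (by
            rintro ⟨⟨x, u⟩, c⟩ ⟨⟨x', u'⟩, c'⟩ hx
            obtain ⟨h1, h2⟩ := Prod.mk.inj hx
            obtain ⟨rfl, rfl⟩ := Fin.snoc_inj.1 h1
            obtain rfl : u = u' := h2
            rfl))
        (exchange h finish j (k + 1) true)

/-- Alice's part of the cheat detection: she measures `{E_0, E_1}` and sends all her qubits if she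
won, nothing otherwise; then she receives Bob's message and performs the final measurement. -/
def aliceFinish (a : ℕ → unitInterval) (k : ℕ) (mine : Bool) :
    Strategy .alice (messagesFrom .alice .bob k 0) (stage k 0 mine) :=
  .send (α' := qubitsOrNothing k) rfl
    (Channel.measureMap (fun p : qubits k × Unit => winner k p.1)
      (fun p => if winner k p.1 = .alice then (none, some p.1) else (some p.1, none))
      (by
        rintro ⟨x, _⟩ ⟨x', _⟩ ho hf
        simp only at ho hf
        rw [ho] at hf
        refine Prod.ext ?_ (Subsingleton.elim (α := Unit) _ _)
        split_ifs at hf <;> simp_all))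
    (.recv (α' := ⟨qubitsOrNothing k × qubitsOrNothing k⟩) (by decide)
      (Channel.ofInjective id Function.injective_id)
      (.measure (finalMeasurement a .bob k)))

/-- Bob's part of the cheat detection: he receives Alice's message, measures `{E_0, E_1}` on his
own qubits and sends them all if he won, nothing otherwise; then he performs the final
measurement. -/
def bobFinish (a : ℕ → unitInterval) (k : ℕ) (mine : Bool) :
    Strategy .bob (messagesFrom .alice .bob k 0) (stage k 0 mine) :=
  .recv (α' := ⟨(qubits k × Unit) × qubitsOrNothing k⟩) (by decide)
    (Channel.ofInjective id Function.injective_id)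
    (.send (α' := ⟨qubitsOrNothing k × qubitsOrNothing k⟩) rfl
      (Channel.measureMap (fun p : (qubits k × Unit) × qubitsOrNothing k => winner k p.1.1)
        (fun p => if winner k p.1.1 = .bob then ((none, p.2), some p.1.1)
          else ((some p.1.1, p.2), none))
        (by
          rintro ⟨⟨x, _⟩, m⟩ ⟨⟨x', _⟩, m'⟩ ho hf
          simp only at ho hf
          rw [ho] at hf
          split_ifs at hf <;> simp_all))
      (.measure (finalMeasurement a .alice k)))

/-- An honest player, who starts with all of its pairs `φ_i` prepared. -/
def honest {me : Player} {l : List Message} (a : ℕ → unitInterval) (n : ℕ) (mine : Bool)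
    (s : Strategy me l (stage 0 n mine)) : Agent me l where
  memory := stage 0 n mine
  init := Matrix.vecMulVec (fun p => unsentState a n mine 0 p.2)
    (star fun p => unsentState a n mine 0 p.2)
  posSemidef := Matrix.posSemidef_vecMulVec_self_star _
  trace_eq_one := by
    rw [Matrix.trace_vecMulVec]
    change ∑ p : (Fin 0 → Fin 2) × unsent n mine,
      unsentState a n mine 0 p.2 * star (unsentState a n mine 0 p.2) = 1
    rw [Fintype.sum_prod_type]
    simpa using unsentState_norm a n mine 0
  strategy := s

/-- The weak coin-flipping protocol with parameters `a 1, …, a n`. -/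
def protocol (n : ℕ) (a : ℕ → unitInterval) : Protocol where
  messages := messagesFrom .alice .bob 0 n
  alice := honest a n true (exchange (opp := .bob) (by decide) (aliceFinish a) n 0 true)
  bob := honest a n false (exchange (opp := .alice) (by decide) (bobFinish a) n 0 false)

/-! ### The bounds -/

/-- The weighted partial trace over the last qubit of a diagonal matrix. -/
def traceLast (a : ℝ) {n : ℕ} (d : (Fin (n + 1) → Fin 2) → ℝ) (x : Fin n → Fin 2) : ℝ :=
  a * d (Fin.snoc x 0) + (1 - a) * d (Fin.snoc x 1)

/-- The weighted root mean square over the last qubit of a diagonal matrix. -/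
def rmsLast (a : ℝ) {n : ℕ} (d : (Fin (n + 1) → Fin 2) → ℝ) (x : Fin n → Fin 2) : ℝ :=
  √(a * d (Fin.snoc x 0) ^ 2 + (1 - a) * d (Fin.snoc x 1) ^ 2)

/-- The nested operation on a diagonal matrix on `n` qubits that applies, from qubit `n` to
qubit `1`, the weighted trace to the qubits sent by the honest player `h` and the weighted root mean
square to the others. -/
def nested (a : ℕ → unitInterval) (h : Player) : (n : ℕ) → ((Fin n → Fin 2) → ℝ) → ℝ
  | 0, d => d Fin.elim0
  | n + 1, d => nested a h n
      (if sender (n + 1) = h then traceLast (a (n + 1)) d else rmsLast (a (n + 1)) d)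

/-- `α = 2 (RMS_{a_1} Tr_{a_2} RMS_{a_3} ⋯ E_0)²`. -/
def boundAlice (n : ℕ) (a : ℕ → unitInterval) : ℝ := 2 * nested a .bob n (E .alice n) ^ 2

/-- `β = 2 (Tr_{a_1} RMS_{a_2} Tr_{a_3} ⋯ E_1)²`. -/
def boundBob (n : ℕ) (a : ℕ → unitInterval) : ℝ := 2 * nested a .alice n (E .bob n) ^ 2

/-- The protocol with parameters `a 1, …, a n` is a weak coin-flipping protocol with `n + 2`
messages; `α` and `β` bound the success of cheating; and the bound `max (α, β) - 1 / 2` on the bias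
that they give equals `ε` up to an error of at most `δ`. -/
def Achieves (n : ℕ) (a : ℕ → unitInterval) (ε δ : ℝ) : Prop :=
  (protocol n a).messages.length = n + 2 ∧
  (protocol n a).IsFair ∧
  (protocol n a).cheatAlice ≤ boundAlice n a ∧
  (protocol n a).cheatBob ≤ boundBob n a ∧
  |max (boundAlice n a) (boundBob n a) - 1 / 2 - ε| ≤ δ

end CoinFlip

end

/-! A cheater sends messages but cannot touch what the honest player already holds: receiving a
message leaves the reduced state of the old memory unchanged. The unused pairs are pure, so they
stay uncorrelated with everything else, and at any moment only the distribution `t` of the qubits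
held by the honest player matters. By Cauchy–Schwarz the final projection onto the line of `(E_w ⊗
E_w)|ψ⟩` succeeds with probability at most `‖E_w ψ‖⁻² (∑ x ∈ E_w, √(p x * t x))²`, where `p` is the
honest distribution. Now remove the qubits from the last to the first: a qubit prepared by the
honest player is averaged, which gives `Tr`, while for a qubit chosen by the cheater another
Cauchy–Schwarz inequality gives `RMS`. Fairness makes `‖E_w ψ‖⁻²` equal to `2`.

The diagonals that occur depend only on the winner. As the winner of the first `k` qubits is decided
by qubit `k` and the winner of the first `k - 1`, each operation replaces one of two numbers, and
interval arithmetic with a few digits certifies the values. -/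

noncomputable section

namespace CoinFlip

section PartialTrace

variable {α β m : Type}

/-- The partial trace of a bipartite state over its left half. -/
def traceLeft [Fintype α] (ρ : Matrix (α × β) (α × β) ℂ) : Matrix β β ℂ :=
  ∑ x, ρ.submatrix (x, ·) (x, ·)

/-- The partial trace of a bipartite state over its right half. -/
def traceRight [Fintype β] (ρ : Matrix (α × β) (α × β) ℂ) : Matrix α α ℂ :=
  ∑ y, ρ.submatrix (·, y) (·, y)

theorem traceLeft_apply [Fintype α] (ρ : Matrix (α × β) (α × β) ℂ) (y y' : β) :
    traceLeft ρ y y' = ∑ x, ρ (x, y) (x, y') := by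
  simp [traceLeft, Matrix.sum_apply]

theorem traceRight_apply [Fintype β] (ρ : Matrix (α × β) (α × β) ℂ) (x x' : α) :
    traceRight ρ x x' = ∑ y, ρ (x, y) (x', y) := by
  simp [traceRight, Matrix.sum_apply]

theorem posSemidef_traceLeft [Fintype α] {ρ : Matrix (α × β) (α × β) ℂ} (hρ : ρ.PosSemidef) :
    (traceLeft ρ).PosSemidef :=
  Matrix.posSemidef_sum _ fun _ _ => hρ.submatrix _

theorem posSemidef_traceRight [Fintype β] {ρ : Matrix (α × β) (α × β) ℂ} (hρ : ρ.PosSemidef) :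
    (traceRight ρ).PosSemidef :=
  Matrix.posSemidef_sum _ fun _ _ => hρ.submatrix _

theorem trace_traceLeft [Fintype α] [Fintype β] (ρ : Matrix (α × β) (α × β) ℂ) :
    (traceLeft ρ).trace = ρ.trace := by
  simp only [Matrix.trace, Matrix.diag, traceLeft_apply, Fintype.sum_prod_type_right]

theorem trace_traceRight [Fintype α] [Fintype β] (ρ : Matrix (α × β) (α × β) ℂ) :
    (traceRight ρ).trace = ρ.trace := by
  simp only [Matrix.trace, Matrix.diag, traceRight_apply, Fintype.sum_prod_type]

theorem traceLeft_kronecker [Fintype α] (M : Matrix α α ℂ) (N : Matrix β β ℂ) :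
    traceLeft (M ⊗ₖ N) = M.trace • N := by
  ext y y'
  simp [traceLeft_apply, Matrix.trace, Finset.sum_mul]

theorem traceRight_kronecker [Fintype β] (M : Matrix α α ℂ) (N : Matrix β β ℂ) :
    traceRight (M ⊗ₖ N) = N.trace • M := by
  ext x x'
  simp [traceRight_apply, Matrix.trace, Finset.mul_sum, mul_comm]

theorem traceLeft_one_kronecker_mul [Fintype α] [DecidableEq α] [Fintype β]
    (N : Matrix β β ℂ) (ρ : Matrix (α × β) (α × β) ℂ) :
    traceLeft (((1 : Matrix α α ℂ) ⊗ₖ N) * ρ) = N * traceLeft ρ := by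
  ext y y'
  simp only [traceLeft_apply, Matrix.mul_apply, Fintype.sum_prod_type, Matrix.kroneckerMap_apply,
    Matrix.one_apply, ite_mul, one_mul, zero_mul, Finset.sum_ite_irrel, Finset.sum_const_zero,
    Finset.sum_ite_eq, Finset.mem_univ, if_true, Finset.mul_sum]
  exact Finset.sum_comm

theorem traceRight_kronecker_one_mul [Fintype α] [Fintype β] [DecidableEq β]
    (M : Matrix α α ℂ) (ρ : Matrix (α × β) (α × β) ℂ) :
    traceRight ((M ⊗ₖ (1 : Matrix β β ℂ)) * ρ) = M * traceRight ρ := by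
  ext x x'
  simp only [traceRight_apply, Matrix.mul_apply, Fintype.sum_prod_type, Matrix.kroneckerMap_apply,
    Matrix.one_apply, mul_ite, mul_one, mul_zero, ite_mul, zero_mul,
    Finset.sum_ite_eq, Finset.mem_univ, if_true, Finset.mul_sum]
  exact Finset.sum_comm

theorem traceLeft_passLeft [Fintype α] [Fintype m]
    (ρ : Matrix (α × (β × m)) (α × (β × m)) ℂ) :
    traceLeft (passLeft ρ) = traceRight (traceLeft ρ) := by
  ext y y'
  simp only [traceLeft_apply, traceRight_apply, passLeft, Matrix.submatrix_apply,
    Fintype.sum_prod_type_right]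

theorem traceRight_traceLeft_passRight [Fintype α] [Fintype m]
    (ρ : Matrix ((α × m) × β) ((α × m) × β) ℂ) :
    traceRight (traceLeft (passRight ρ)) = traceLeft ρ := by
  ext y y'
  simp only [traceLeft_apply, traceRight_apply, passRight, Matrix.submatrix_apply,
    Fintype.sum_prod_type_right]

theorem traceRight_passRight [Fintype β] [Fintype m]
    (ρ : Matrix ((α × m) × β) ((α × m) × β) ℂ) :
    traceRight (passRight ρ) = traceRight (traceRight ρ) := by
  ext x x'
  simp only [traceRight_apply, passRight, Matrix.submatrix_apply, Fintype.sum_prod_type_right]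

theorem traceRight_traceRight_passLeft [Fintype β] [Fintype m]
    (ρ : Matrix (α × (β × m)) (α × (β × m)) ℂ) :
    traceRight (traceRight (passLeft ρ)) = traceRight ρ := by
  ext x x'
  simp only [traceRight_apply, passLeft, Matrix.submatrix_apply, Fintype.sum_prod_type_right]

end PartialTrace

namespace Channel

attribute [instance] Channel.fintype

variable {α β γ : Type} [Fintype α] [DecidableEq α] [Fintype β]

/-- The action of a channel on a state. -/
def map (C : Channel α β) : Matrix α α ℂ →ₗ[ℂ] Matrix β β ℂ where
  toFun σ := ∑ k, C.kraus k * σ * (C.kraus k)ᴴ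
  map_add' σ τ := by simp only [Matrix.mul_add, Matrix.add_mul, Finset.sum_add_distrib]
  map_smul' c σ := by
    simp only [Matrix.mul_smul, Matrix.smul_mul, Finset.smul_sum, RingHom.id_apply]

theorem map_apply (C : Channel α β) (σ : Matrix α α ℂ) :
    C.map σ = ∑ k, C.kraus k * σ * (C.kraus k)ᴴ :=
  rfl

theorem trace_map (C : Channel α β) (σ : Matrix α α ℂ) : (C.map σ).trace = σ.trace := by
  rw [map_apply, Matrix.trace_sum]
  simp only [Matrix.trace_mul_cycle _ σ]
  rw [← Matrix.trace_sum, ← Finset.sum_mul, C.complete, one_mul]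

theorem posSemidef_map (C : Channel α β) {σ : Matrix α α ℂ} (hσ : σ.PosSemidef) :
    (C.map σ).PosSemidef :=
  Matrix.posSemidef_sum _ fun _ _ => hσ.mul_mul_conjTranspose_same _

variable [Fintype γ] [DecidableEq γ]

theorem posSemidef_onLeft (C : Channel α β) {ρ : Matrix (α × γ) (α × γ) ℂ} (hρ : ρ.PosSemidef) :
    (C.onLeft ρ).PosSemidef :=
  Matrix.posSemidef_sum _ fun _ _ => hρ.mul_mul_conjTranspose_same _

theorem posSemidef_onRight (C : Channel α β) {ρ : Matrix (γ × α) (γ × α) ℂ}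
    (hρ : ρ.PosSemidef) : (C.onRight ρ).PosSemidef :=
  Matrix.posSemidef_sum _ fun _ _ => hρ.mul_mul_conjTranspose_same _

theorem submatrix_onLeft (C : Channel α β) (ρ : Matrix (α × γ) (α × γ) ℂ) (z z' : γ) :
    (C.onLeft ρ).submatrix (·, z) (·, z') = C.map (ρ.submatrix (·, z) (·, z')) := by
  ext y y'
  simp [onLeft, map_apply, Matrix.sum_apply, Matrix.mul_apply, Fintype.sum_prod_type,
    Matrix.one_apply, Finset.sum_mul, apply_ite (starRingEnd ℂ)]

theorem submatrix_onRight (C : Channel α β) (ρ : Matrix (γ × α) (γ × α) ℂ) (z z' : γ) :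
    (C.onRight ρ).submatrix (z, ·) (z', ·) = C.map (ρ.submatrix (z, ·) (z', ·)) := by
  ext y y'
  simp [onRight, map_apply, Matrix.sum_apply, Matrix.mul_apply, Fintype.sum_prod_type,
    Matrix.one_apply, Finset.sum_mul, apply_ite (starRingEnd ℂ)]

theorem traceRight_onLeft (C : Channel α β) (ρ : Matrix (α × γ) (α × γ) ℂ) :
    traceRight (C.onLeft ρ) = C.map (traceRight ρ) := by
  simp only [traceRight, submatrix_onLeft, map_sum]

theorem traceLeft_onRight (C : Channel α β) (ρ : Matrix (γ × α) (γ × α) ℂ) :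
    traceLeft (C.onRight ρ) = C.map (traceLeft ρ) := by
  simp only [traceLeft, submatrix_onRight, map_sum]

theorem traceLeft_onLeft (C : Channel α β) (ρ : Matrix (α × γ) (α × γ) ℂ) :
    traceLeft (C.onLeft ρ) = traceLeft ρ := by
  ext z z'
  have h := C.trace_map (ρ.submatrix (·, z) (·, z'))
  simpa only [← submatrix_onLeft, Matrix.trace, Matrix.diag, Matrix.submatrix_apply,
    ← traceLeft_apply] using h

theorem traceRight_onRight (C : Channel α β) (ρ : Matrix (γ × α) (γ × α) ℂ) :
    traceRight (C.onRight ρ) = traceRight ρ := by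
  ext z z'
  have h := C.trace_map (ρ.submatrix (z, ·) (z', ·))
  simpa only [← submatrix_onRight, Matrix.trace, Matrix.diag, Matrix.submatrix_apply,
    ← traceRight_apply] using h

end Channel

namespace Channel

variable {α β ω : Type} [Fintype α] [DecidableEq α] [Fintype β] [DecidableEq β]
  [Fintype ω] [DecidableEq ω]

theorem measureMap_map_apply (o : α → ω) (f : α → β)
    (hf : ∀ x x', o x = o x' → f x = f x' → x = x') (σ : Matrix α α ℂ) (y y' : β) :
    (measureMap o f hf).map σ y y' =
      ∑ x, ∑ x', if o x = o x' ∧ f x = y ∧ f x' = y' then σ x x' else 0 := by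
  let K (w : ω) : Matrix β α ℂ := Matrix.of fun y x => if o x = w ∧ y = f x then 1 else 0
  change (∑ w, K w * σ * (K w)ᴴ) y y' = _
  have branch (w : ω) : (K w * σ * (K w)ᴴ) y y' =
      ∑ x, ∑ x', if o x = w ∧ o x' = w ∧ f x = y ∧ f x' = y' then σ x x' else 0 := by
    simp only [K, Matrix.mul_apply, Matrix.conjTranspose_apply, Matrix.of_apply, Finset.sum_mul]
    rw [Finset.sum_comm]
    refine Finset.sum_congr rfl fun x _ => Finset.sum_congr rfl fun x' _ => ?_
    grind [star_one, star_zero]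
  simp only [Matrix.sum_apply, branch]
  rw [Finset.sum_comm]
  refine Finset.sum_congr rfl fun x _ => Finset.sum_comm.trans (Finset.sum_congr rfl fun x' _ => ?_)
  rw [Finset.sum_eq_single (o x) (fun w _ hw => if_neg fun h => hw h.1.symm) (by simp)]
  simp [eq_comm]

theorem measureMap_map_apply_self (o : α → ω) (f : α → β)
    (hf : ∀ x x', o x = o x' → f x = f x' → x = x') (σ : Matrix α α ℂ) (y : β) :
    (measureMap o f hf).map σ y y = ∑ x, if f x = y then σ x x else 0 := by
  rw [measureMap_map_apply]
  refine Finset.sum_congr rfl fun x _ => ?_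
  rw [Finset.sum_eq_single x]
  · simp
  · intro x' _ hx'
    exact if_neg fun h => hx' (hf x x' h.1 (h.2.1.trans h.2.2.symm)).symm
  · simp

theorem traceRight_measureMap_map_apply_of_fiber {m : Type} [Fintype m] [DecidableEq m]
    (o : α → ω) (f : α → β × m) (hf : ∀ x x', o x = o x' → f x = f x' → x = x') (σ : Matrix α α ℂ)
    {x : α} {y : β} (hxy : ∀ x', (f x').1 = y ↔ x' = x) :
    traceRight ((measureMap o f hf).map σ) y y = σ x x := by
  calc _ = ∑ x', if (f x').1 = y then σ x' x' else 0 := by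
        simp only [traceRight_apply, measureMap_map_apply_self, Prod.ext_iff]
        rw [Finset.sum_comm]
        simp [ite_and]
    _ = σ x x := by simp [hxy]

variable {f : α → β} (hf : Function.Injective f)

theorem ofInjective_map {g : β → α} (hg : Function.RightInverse g f) (σ : Matrix α α ℂ) :
    (ofInjective f hf).map σ = σ.submatrix g g := by
  have hfg (x : α) (y : β) : f x = y ↔ x = g y := by rw [← hf.eq_iff, hg y]
  ext y y'
  simp [ofInjective, measureMap_map_apply, hfg, ite_and]

theorem ofInjective_onLeft {γ : Type} [Fintype γ] [DecidableEq γ] {g : β → α}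
    (hg : Function.RightInverse g f) (ρ : Matrix (α × γ) (α × γ) ℂ) :
    (ofInjective f hf).onLeft ρ = ρ.submatrix (Prod.map g id) (Prod.map g id) := by
  ext ⟨y, z⟩ ⟨y', z'⟩
  have h := congr_fun₂ ((ofInjective f hf).submatrix_onLeft ρ z z') y y'
  rwa [ofInjective_map hf hg] at h

theorem ofInjective_onRight {γ : Type} [Fintype γ] [DecidableEq γ] {g : β → α}
    (hg : Function.RightInverse g f) (ρ : Matrix (γ × α) (γ × α) ℂ) :
    (ofInjective f hf).onRight ρ = ρ.submatrix (Prod.map id g) (Prod.map id g) := by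
  ext ⟨z, y⟩ ⟨z', y'⟩
  have h := congr_fun₂ ((ofInjective f hf).submatrix_onRight ρ z z') y y'
  rwa [ofInjective_map hf hg] at h

end Channel

theorem Player.eq_of_ne {p q r : Player} (hp : p ≠ r) (hq : q ≠ r) : p = q := by
  cases p <;> cases q <;> cases r <;> simp_all

theorem sum_player {M : Type*} [AddCommMonoid M] (f : Player → M) :
    ∑ w, f w = f .alice + f .bob :=
  Finset.sum_pair (by decide)

theorem Measurement.sum_proj {α : Type} [Fintype α] [DecidableEq α] (M : Measurement α) :
    ∑ w, M.proj w = 1 := by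
  rw [sum_player, M.complete]

/-- The honest player `me`, in the reduced state `σ` and from some point of the protocol on,
outputs `y` with probability at most `p`, whatever the opponent does: the reduced state after a
message of the opponent is only known to restrict, on the old memory, to the one before. -/
def Strategy.OutcomeLE {me : Player} (y : Player) (p : ℝ) :
    {l : List Message} → {α : Register} → Strategy me l α → Matrix α α ℂ → Prop
  | _, _, .measure M, σ => (M.proj y * σ).trace.re ≤ p
  | _, _, .send _ C next, σ => next.OutcomeLE y p (traceRight (C.map σ))
  | _, _, .recv _ C next, σ =>
      ∀ σ', σ'.PosSemidef → traceRight σ' = σ → next.OutcomeLE y p (C.map σ')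

theorem Strategy.OutcomeLE.mono {me y : Player} {p q : ℝ} (hpq : p ≤ q) {l : List Message}
    {α : Register} {s : Strategy me l α} {σ : Matrix α α ℂ} (h : s.OutcomeLE y p σ) :
    s.OutcomeLE y q σ := by
  induction s with
  | measure M => exact le_trans h hpq
  | send _ C next ih => exact ih h
  | recv _ C next ih => exact fun σ' hσ' hσ => ih (h σ' hσ' hσ)

theorem posSemidef_passLeft {α β m : Type} {ρ : Matrix (α × (β × m)) (α × (β × m)) ℂ}
    (hρ : ρ.PosSemidef) : (passLeft ρ).PosSemidef :=
  hρ.submatrix _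

theorem posSemidef_passRight {α β m : Type} {ρ : Matrix ((α × m) × β) ((α × m) × β) ℂ}
    (hρ : ρ.PosSemidef) : (passRight ρ).PosSemidef :=
  hρ.submatrix _

section Reduction

variable {y : Player} {p : ℝ} {l : List Message} {α β : Register}

theorem sum_run_measure_left (M : Measurement α) (N : Measurement β)
    (ρ : Matrix (α × β) (α × β) ℂ) :
    ∑ x, run [] (.measure M) (.measure N) ρ x y = (N.proj y * traceLeft ρ).trace.re := by
  simp only [run]
  rw [← traceLeft_one_kronecker_mul, trace_traceLeft, ← M.sum_proj, sum_player, sum_player,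
    Matrix.add_kronecker, add_mul, Matrix.trace_add, Complex.add_re]

theorem sum_run_measure_right (M : Measurement α) (N : Measurement β)
    (ρ : Matrix (α × β) (α × β) ℂ) :
    ∑ x, run [] (.measure M) (.measure N) ρ y x = (M.proj y * traceRight ρ).trace.re := by
  simp only [run]
  rw [← traceRight_kronecker_one_mul, trace_traceRight, ← N.sum_proj, sum_player, sum_player,
    Matrix.kronecker_add, add_mul, Matrix.trace_add, Complex.add_re]

theorem Strategy.OutcomeLE.sum_run_left_le {B : Strategy .bob l β}
    {ρ : Matrix (α × β) (α × β) ℂ} (hB : B.OutcomeLE y p (traceLeft ρ)) (hρ : ρ.PosSemidef)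
    (A : Strategy .alice l α) : ∑ x, run l A B ρ x y ≤ p := by
  induction B generalizing α with
  | measure N =>
    obtain @⟨_, M⟩ := A
    exact (sum_run_measure_left M N ρ).trans_le hB
  | send h D B ih =>
    cases A with
    | send h' _ _ => exact nomatch h.symm.trans h'
    | recv _ C A =>
      simp only [run]
      refine ih ?_ (C.posSemidef_onLeft (posSemidef_passLeft (D.posSemidef_onRight hρ))) A
      rwa [Channel.traceLeft_onLeft, traceLeft_passLeft, Channel.traceLeft_onRight]
  | recv h D B ih =>
    cases A with
    | recv h' _ _ => exact absurd (Player.eq_of_ne h (by decide)) h'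
    | send _ C A =>
      simp only [run]
      have hρ' := posSemidef_passRight (C.posSemidef_onLeft hρ)
      refine ih ?_ (D.posSemidef_onRight hρ') A
      rw [Channel.traceLeft_onRight]
      refine hB _ (posSemidef_traceLeft hρ') ?_
      rw [traceRight_traceLeft_passRight, Channel.traceLeft_onLeft]

theorem Strategy.OutcomeLE.sum_run_right_le {A : Strategy .alice l α}
    {ρ : Matrix (α × β) (α × β) ℂ} (hA : A.OutcomeLE y p (traceRight ρ)) (hρ : ρ.PosSemidef)
    (B : Strategy .bob l β) : ∑ x, run l A B ρ y x ≤ p := by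
  induction A generalizing β with
  | measure M =>
    obtain @⟨_, N⟩ := B
    exact (sum_run_measure_right M N ρ).trans_le hA
  | send h C A ih =>
    cases B with
    | send h' _ _ => exact nomatch h.symm.trans h'
    | recv _ D B =>
      simp only [run]
      refine ih ?_ (D.posSemidef_onRight (posSemidef_passRight (C.posSemidef_onLeft hρ))) B
      rwa [Channel.traceRight_onRight, traceRight_passRight, Channel.traceRight_onLeft]
  | recv h C A ih =>
    cases B with
    | recv h' _ _ => exact absurd (Player.eq_of_ne h (by decide)) h'
    | send _ D B =>
      simp only [run]
      have hρ' := posSemidef_passLeft (D.posSemidef_onRight hρ)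
      refine ih ?_ (C.posSemidef_onLeft hρ') B
      rw [Channel.traceRight_onLeft]
      refine hA _ (posSemidef_traceRight hρ') ?_
      rw [traceRight_traceRight_passLeft, Channel.traceRight_onRight]

end Reduction

section Pure

variable {α β γ : Type}

/-- The density matrix `|ψ⟩⟨ψ|` of the pure state with amplitudes `ψ`. -/
def pureState (ψ : α → ℂ) : Matrix α α ℂ := Matrix.vecMulVec ψ (star ψ)

theorem pureState_apply (ψ : α → ℂ) (x x' : α) : pureState ψ x x' = ψ x * star (ψ x') :=
  rfl

theorem pureState_kronecker (ψ : α → ℂ) (χ : β → ℂ) :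
    pureState (fun p : α × β => ψ p.1 * χ p.2) = pureState ψ ⊗ₖ pureState χ := by
  ext p q
  simp only [pureState_apply, Matrix.kroneckerMap_apply, star_mul']
  ring

theorem posSemidef_pureState [Finite α] (ψ : α → ℂ) : (pureState ψ).PosSemidef :=
  Matrix.posSemidef_vecMulVec_self_star ψ

variable [Fintype α] [Fintype β] [Fintype γ]

theorem trace_pureState (ψ : α → ℂ) : (pureState ψ).trace = ∑ x, ψ x * star (ψ x) := rfl

theorem pureState_mul_self {ψ : α → ℂ} (hψ : (pureState ψ).trace = 1) :
    pureState ψ * pureState ψ = pureState ψ := by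
  rw [pureState, Matrix.trace_vecMulVec, dotProduct_comm] at hψ
  rw [pureState, Matrix.vecMulVec_mul_vecMulVec, hψ, one_smul]

open scoped MatrixOrder Matrix.Norms.L2Operator in
theorem exists_eq_conjTranspose_mul_self {M : Matrix α α ℂ} (hM : M.PosSemidef) :
    ∃ B : Matrix α α ℂ, M = Bᴴ * B := by
  classical
  exact CStarAlgebra.nonneg_iff_eq_star_mul_self.mp hM.nonneg

theorem mul_eq_zero_of_trace_mul_eq_zero {M Q : Matrix α α ℂ}
    (hM : M.PosSemidef) (hQ : Q.IsHermitian) (hQQ : Q * Q = Q) (h : (M * Q).trace = 0) :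
    M * Q = 0 := by
  obtain ⟨B, rfl⟩ := exists_eq_conjTranspose_mul_self hM
  have hBQ : B * Q = 0 := by
    rw [← Matrix.trace_conjTranspose_mul_self_eq_zero_iff, Matrix.conjTranspose_mul, hQ.eq,
      mul_assoc, Matrix.trace_mul_comm, ← h]
    simp only [mul_assoc, hQQ]
  rw [mul_assoc, hBQ, mul_zero]

theorem exists_eq_kronecker_pureState [DecidableEq α] {ψ : β → ℂ}
    {σ : Matrix (α × β) (α × β) ℂ} (hleft : ((1 : Matrix α α ℂ) ⊗ₖ pureState ψ) * σ = σ)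
    (hright : σ * ((1 : Matrix α α ℂ) ⊗ₖ pureState ψ) = σ) :
    ∃ T : Matrix α α ℂ, σ = T ⊗ₖ pureState ψ := by
  refine ⟨Matrix.of fun x x' => ∑ v, ∑ v', star (ψ v) * σ (x, v) (x', v') * ψ v', ?_⟩
  ext ⟨x, u⟩ ⟨x', u'⟩
  conv_lhs => rw [← hright, ← hleft]
  simp only [Matrix.mul_apply, Fintype.sum_prod_type, Matrix.kroneckerMap_apply, Matrix.one_apply,
    Matrix.of_apply, pureState_apply, ite_mul, mul_ite, one_mul, zero_mul, mul_zero,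
    Finset.sum_ite_irrel, Finset.sum_const_zero, Finset.sum_ite_eq, Finset.sum_ite_eq',
    Finset.mem_univ, if_true, Finset.sum_mul]
  rw [Finset.sum_comm]
  refine Finset.sum_congr rfl fun v _ => Finset.sum_congr rfl fun v' _ => ?_
  ring

theorem eq_traceRight_kronecker_pureState {ψ : β → ℂ} (hψ : (pureState ψ).trace = 1)
    {σ : Matrix (α × β) (α × β) ℂ} (hσ : σ.PosSemidef) {c : ℂ}
    (h : traceLeft σ = c • pureState ψ) : σ = traceRight σ ⊗ₖ pureState ψ := by
  classical
  set P := pureState ψ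
  have hPP : P * P = P := pureState_mul_self hψ
  have hP : Pᴴ = P := (posSemidef_pureState ψ).isHermitian
  have hcompl : (1 - P) * (1 - P) = 1 - P := by simp [sub_mul, mul_sub, hPP]
  have hsplit : (1 : Matrix α α ℂ) ⊗ₖ P = 1 - 1 ⊗ₖ (1 - P) := by
    rw [eq_sub_iff_add_eq, ← Matrix.kronecker_add, add_sub_cancel, Matrix.one_kronecker_one]
  have hperp : σ * ((1 : Matrix α α ℂ) ⊗ₖ (1 - P)) = 0 := by
    refine mul_eq_zero_of_trace_mul_eq_zero hσ ?_ ?_ ?_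
    · rw [Matrix.IsHermitian, Matrix.conjTranspose_kronecker]
      simp [hP]
    · rw [← Matrix.mul_kronecker_mul, hcompl, one_mul]
    · rw [Matrix.trace_mul_comm, ← trace_traceLeft, traceLeft_one_kronecker_mul, h]
      simp [sub_mul, hPP]
  have hright : σ * ((1 : Matrix α α ℂ) ⊗ₖ P) = σ := by
    rw [hsplit, mul_sub, mul_one, hperp, sub_zero]
  have hleft : ((1 : Matrix α α ℂ) ⊗ₖ P) * σ = σ := by
    simpa [Matrix.conjTranspose_mul, Matrix.conjTranspose_kronecker, hσ.isHermitian.eq, hP]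
      using congr_arg Matrix.conjTranspose hright
  obtain ⟨T, hT⟩ := exists_eq_kronecker_pureState hleft hright
  conv_rhs => rw [hT, traceRight_kronecker, hψ, one_smul]
  exact hT

end Pure

/-- The distribution of the two values of a qubit that is `0` with probability `a`. -/
def bitProb (a : ℝ) : Fin 2 → ℝ := ![a, 1 - a]

theorem bitProb_nonneg (a : unitInterval) (b : Fin 2) : 0 ≤ bitProb a b := by
  fin_cases b
  · exact a.2.1
  · exact sub_nonneg.2 a.2.2

theorem sum_bitProb (a : ℝ) : ∑ b, bitProb a b = 1 := by
  simp [bitProb]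

theorem phi_apply (a : unitInterval) (b c : Fin 2) :
    phi a (b, c) = if b = c then ((√(bitProb a b) : ℝ) : ℂ) else 0 := by
  fin_cases b <;> fin_cases c <;> simp [phi, bitProb]

theorem traceLast_eq_sum (a : ℝ) {n : ℕ} (d : (Fin (n + 1) → Fin 2) → ℝ) (x : Fin n → Fin 2) :
    traceLast a d x = ∑ b, bitProb a b * d (Fin.snoc x b) := by
  simp [traceLast, bitProb]

theorem rmsLast_eq_sqrt_sum (a : ℝ) {n : ℕ} (d : (Fin (n + 1) → Fin 2) → ℝ)
    (x : Fin n → Fin 2) : rmsLast a d x = √(∑ b, bitProb a b * d (Fin.snoc x b) ^ 2) := by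
  simp [rmsLast, bitProb]

theorem traceLast_nonneg (a : unitInterval) {n : ℕ} {d : (Fin (n + 1) → Fin 2) → ℝ} (hd : 0 ≤ d) :
    0 ≤ traceLast a d := fun x => by
  rw [traceLast_eq_sum]
  exact Finset.sum_nonneg fun b _ => mul_nonneg (bitProb_nonneg a b) (hd _)

theorem rmsLast_nonneg (a : ℝ) {n : ℕ} (d : (Fin (n + 1) → Fin 2) → ℝ) : 0 ≤ rmsLast a d :=
  fun _ => Real.sqrt_nonneg _

/-- The probability of the bit string `x` when one half of the state `psi` is measured. -/
def stringProb (a : ℕ → unitInterval) (k : ℕ) (x : Fin k → Fin 2) : ℝ :=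
  ∏ i : Fin k, bitProb (a (i + 1)) (x i)

theorem stringProb_nonneg (a : ℕ → unitInterval) (k : ℕ) (x : Fin k → Fin 2) :
    0 ≤ stringProb a k x :=
  Finset.prod_nonneg fun _ _ => bitProb_nonneg _ _

theorem stringProb_snoc (a : ℕ → unitInterval) (k : ℕ) (x : Fin k → Fin 2) (b : Fin 2) :
    stringProb a (k + 1) (Fin.snoc x b) = stringProb a k x * bitProb (a (k + 1)) b := by
  simp [stringProb, Fin.prod_univ_castSucc]

theorem sum_snoc {M : Type*} [AddCommMonoid M] {k : ℕ} (f : (Fin (k + 1) → Fin 2) → M) :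
    ∑ x, f x = ∑ x : Fin k → Fin 2, ∑ b, f (Fin.snoc x b) := by
  rw [← (Fin.snocEquiv fun _ : Fin (k + 1) => Fin 2).sum_comp, Fintype.sum_prod_type_right]
  rfl

/-- The overlap, weighted by `d`, of the square roots of a distribution `t` on bit strings and of
the honest one. -/
def overlap (a : ℕ → unitInterval) (k : ℕ) (d t : (Fin k → Fin 2) → ℝ) : ℝ :=
  ∑ x, d x * (√(stringProb a k x) * √(t x))

theorem overlap_nonneg (a : ℕ → unitInterval) {k : ℕ} {d : (Fin k → Fin 2) → ℝ} (hd : 0 ≤ d)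
    (t : (Fin k → Fin 2) → ℝ) : 0 ≤ overlap a k d t :=
  Finset.sum_nonneg fun x _ => mul_nonneg (hd x) (by positivity)

theorem overlap_of_honest (a : ℕ → unitInterval) {k : ℕ} (d : (Fin (k + 1) → Fin 2) → ℝ)
    {t' : (Fin (k + 1) → Fin 2) → ℝ} {t : (Fin k → Fin 2) → ℝ}
    (h : ∀ x b, t' (Fin.snoc x b) = bitProb (a (k + 1)) b * t x) :
    overlap a (k + 1) d t' = overlap a k (traceLast (a (k + 1)) d) t := by
  simp only [overlap, sum_snoc, traceLast_eq_sum, Finset.sum_mul]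
  refine Finset.sum_congr rfl fun x _ => Finset.sum_congr rfl fun b _ => ?_
  have hb := bitProb_nonneg (a (k + 1)) b
  rw [h, stringProb_snoc, Real.sqrt_mul (stringProb_nonneg _ _ _), Real.sqrt_mul hb]
  linear_combination d (Fin.snoc x b) * (√(stringProb a k x) * √(t x)) * Real.mul_self_sqrt hb

theorem overlap_le_of_cheat (a : ℕ → unitInterval) {k : ℕ} (d : (Fin (k + 1) → Fin 2) → ℝ)
    {t' : (Fin (k + 1) → Fin 2) → ℝ} {t : (Fin k → Fin 2) → ℝ} (ht : 0 ≤ t')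
    (h : ∀ x, ∑ b, t' (Fin.snoc x b) = t x) :
    overlap a (k + 1) d t' ≤ overlap a k (rmsLast (a (k + 1)) d) t := by
  rw [overlap, sum_snoc]
  refine Finset.sum_le_sum fun x _ => ?_
  have hp (b : Fin 2) := bitProb_nonneg (a (k + 1)) b
  calc ∑ b, d (Fin.snoc x b) * (√(stringProb a (k + 1) (Fin.snoc x b)) * √(t' (Fin.snoc x b)))
      = √(stringProb a k x) *
          ∑ b, √(bitProb (a (k + 1)) b) * d (Fin.snoc x b) * √(t' (Fin.snoc x b)) := by
        rw [Finset.mul_sum]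
        refine Finset.sum_congr rfl fun b _ => ?_
        rw [stringProb_snoc, Real.sqrt_mul (stringProb_nonneg _ _ _)]
        ring
    _ ≤ √(stringProb a k x) * (√(∑ b, (√(bitProb (a (k + 1)) b) * d (Fin.snoc x b)) ^ 2) *
          √(∑ b, √(t' (Fin.snoc x b)) ^ 2)) := by
        gcongr
        exact Real.sum_mul_le_sqrt_mul_sqrt _ _ _
    _ = rmsLast (a (k + 1)) d x * (√(stringProb a k x) * √(t x)) := by
        simp only [mul_pow, Real.sq_sqrt (hp _), Real.sq_sqrt (ht _), h, ← rmsLast_eq_sqrt_sum]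
        ring

theorem sender_succ (k : ℕ) : sender (k + 1) = (sender k).other := by
  simp only [sender, Nat.odd_add_one]
  split_ifs <;> rfl

theorem trace_pureState_unsentState (a : ℕ → unitInterval) (j : ℕ) (mine : Bool) (k : ℕ) :
    (pureState (unsentState a j mine k)).trace = 1 :=
  unsentState_norm a j mine k

/-- Detach the last qubit of a bit string. -/
def unsnoc {k : ℕ} (x : Fin (k + 1) → Fin 2) : (Fin k → Fin 2) × Fin 2 :=
  (Fin.init x, x (Fin.last k))

theorem unsnoc_snoc {k : ℕ} (x : Fin k → Fin 2) (b : Fin 2) :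
    unsnoc (Fin.snoc x b : Fin (k + 1) → Fin 2) = (x, b) := by
  simp [unsnoc]

/-- The probabilities of the basis states in a given state. -/
def diagProb {α : Type} (ρ : Matrix α α ℂ) (x : α) : ℝ := (ρ x x).re

theorem diagProb_nonneg {α : Type} {ρ : Matrix α α ℂ} (hρ : ρ.PosSemidef) : 0 ≤ diagProb ρ :=
  fun _ => (Complex.nonneg_iff.1 hρ.diag_nonneg).1

theorem diagProb_kronecker_traceRight_phi (a : unitInterval) {α : Type} (ρ : Matrix α α ℂ)
    (x : α) (b : Fin 2) :
    diagProb (ρ ⊗ₖ traceRight (pureState (phi a))) (x, b) = bitProb a b * diagProb ρ x := by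
  have h : traceRight (pureState (phi a)) b b = (bitProb a b : ℂ) := by
    simp only [traceRight_apply, pureState_apply, phi_apply, apply_ite star, star_zero, mul_ite,
      ite_mul, zero_mul, mul_zero]
    simp [← Complex.ofReal_mul, Real.mul_self_sqrt (bitProb_nonneg a b)]
  rw [diagProb, Matrix.kroneckerMap_apply, h, mul_comm, Complex.re_ofReal_mul, diagProb]

/-- The honest player `me` holds halves of `k` qubits in the state `ρ` and its unused pairs; then
it outputs `w` with a probability that is at most `K` times the square of the overlap, weighted by
`d`, of the distribution of the `k` qubits with the honest one. -/
def Strategy.OverlapBound {me : Player} {l : List Message} (a : ℕ → unitInterval) (w : Player)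
    (K : ℝ) {k j : ℕ} {mine : Bool} (s : Strategy me l (stage k j mine))
    (d : (Fin k → Fin 2) → ℝ) : Prop :=
  ∀ ρ : Matrix (qubits k) (qubits k) ℂ, ρ.PosSemidef →
    s.OutcomeLE w (K * overlap a k d (diagProb ρ) ^ 2) (ρ ⊗ₖ pureState (unsentState a j mine k))

section

variable {U : Type} [Fintype U] [DecidableEq U] {k : ℕ}

theorem snoc_unsnoc (x : Fin (k + 1) → Fin 2) :
    (Fin.snoc (unsnoc x).1 (unsnoc x).2 : Fin (k + 1) → Fin 2) = x :=
  Fin.snoc_init_self x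

theorem traceRight_map_sendHalf (b : unitInterval) (χ : U → ℂ)
    (ρ : Matrix (Fin k → Fin 2) (Fin k → Fin 2) ℂ)
    (hf : Function.Injective fun p : (Fin k → Fin 2) × ((Fin 2 × Fin 2) × U) =>
      (((Fin.snoc p.1 p.2.1.1 : Fin (k + 1) → Fin 2), p.2.2), p.2.1.2)) :
    traceRight ((Channel.ofInjective _ hf).map
        (ρ ⊗ₖ pureState fun u : (Fin 2 × Fin 2) × U => phi b u.1 * χ u.2)) =
      (ρ ⊗ₖ traceRight (pureState (phi b))).submatrix unsnoc unsnoc ⊗ₖ pureState χ := by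
  rw [Channel.ofInjective_map (g := fun p => ((unsnoc p.1.1).1, ((unsnoc p.1.1).2, p.2), p.1.2))
    hf fun p => by simp only [snoc_unsnoc]]
  ext ⟨x, u⟩ ⟨y, v⟩
  simp only [traceRight_apply, Matrix.submatrix_apply, Matrix.kroneckerMap_apply, pureState_apply,
    Finset.mul_sum, Finset.sum_mul, star_mul']
  exact Finset.sum_congr rfl fun c _ => by ring

theorem map_receiveHalf {χ : U → ℂ} (hχ : (pureState χ).trace = 1)
    {ρ : Matrix (Fin k → Fin 2) (Fin k → Fin 2) ℂ}
    {σ : Matrix (((Fin k → Fin 2) × U) × Fin 2) (((Fin k → Fin 2) × U) × Fin 2) ℂ}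
    (hσ : σ.PosSemidef) (hσρ : traceRight σ = ρ ⊗ₖ pureState χ)
    (hf : Function.Injective fun p : ((Fin k → Fin 2) × U) × Fin 2 =>
      ((Fin.snoc p.1.1 p.2 : Fin (k + 1) → Fin 2), p.1.2)) :
    ∃ ρ' : Matrix (Fin (k + 1) → Fin 2) (Fin (k + 1) → Fin 2) ℂ, ρ'.PosSemidef ∧
      (∀ x, ∑ b, diagProb ρ' (Fin.snoc x b) = diagProb ρ x) ∧
      (Channel.ofInjective _ hf).map σ = ρ' ⊗ₖ pureState χ := by
  let e : ((Fin k → Fin 2) × Fin 2) × U → ((Fin k → Fin 2) × U) × Fin 2 :=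
    fun p => ((p.1.1, p.2), p.1.2)
  have htrace : traceLeft (σ.submatrix e e) = ρ.trace • pureState χ := by
    rw [← traceLeft_kronecker, ← hσρ]
    ext u v
    simp only [e, traceLeft_apply, traceRight_apply, Matrix.submatrix_apply,
      Fintype.sum_prod_type]
  have hproduct : σ.submatrix e e = traceRight (σ.submatrix e e) ⊗ₖ pureState χ :=
    eq_traceRight_kronecker_pureState hχ (hσ.submatrix e) htrace
  refine ⟨(traceRight (σ.submatrix e e)).submatrix unsnoc unsnoc,
    (posSemidef_traceRight (hσ.submatrix e)).submatrix unsnoc, fun x => ?_, ?_⟩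
  · have hmarginal : ∑ b, traceRight (σ.submatrix e e) (x, b) (x, b) = ρ x x := by
      calc _ = traceRight (ρ ⊗ₖ pureState χ) x x := by
            rw [← hσρ]
            simp only [e, traceRight_apply, Matrix.submatrix_apply]
            exact Finset.sum_comm
        _ = ρ x x := by rw [traceRight_kronecker, hχ, one_smul]
    simp only [diagProb, Matrix.submatrix_apply, unsnoc_snoc, ← Complex.re_sum, hmarginal]
  · rw [Channel.ofInjective_map (g := fun p => (((unsnoc p.1).1, p.2), (unsnoc p.1).2)) hf
      fun p => by simp only [snoc_unsnoc]]
    ext p q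
    exact congrFun₂ hproduct (unsnoc p.1, p.2) (unsnoc q.1, q.2)

end

section Exchange

variable {me opp w : Player} {hne : opp ≠ me}
  {finish : ∀ (k : ℕ) (mine : Bool), Strategy me (messagesFrom .alice .bob k 0) (stage k 0 mine)}
  {a : ℕ → unitInterval} {K : ℝ} {k j : ℕ}

theorem overlapBound_exchange_send {d : (Fin (k + 1) → Fin 2) → ℝ}
    (h : (exchange hne finish j (k + 1) false).OverlapBound a w K d) :
    (exchange hne finish (j + 1) k true).OverlapBound a w K (traceLast (a (k + 1)) d) := by
  intro ρ hρ
  let ρ' : Matrix (qubits (k + 1)) (qubits (k + 1)) ℂ :=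
    (ρ ⊗ₖ traceRight (pureState (phi (a (k + 1))))).submatrix unsnoc unsnoc
  have hρ' : ρ'.PosSemidef :=
    (hρ.kronecker (posSemidef_traceRight (posSemidef_pureState _))).submatrix _
  have hoverlap : overlap a (k + 1) d (diagProb ρ') =
      overlap a k (traceLast (a (k + 1)) d) (diagProb ρ) :=
    overlap_of_honest a d fun x b => by
      rw [← diagProb_kronecker_traceRight_phi, ← unsnoc_snoc]
      rfl
  have hnext := h ρ' hρ'
  rw [hoverlap] at hnext
  exact (congrArg (Strategy.OutcomeLE w _ (exchange hne finish j (k + 1) false))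
    (traceRight_map_sendHalf (a (k + 1)) (unsentState a j false (k + 1)) ρ _)).mpr hnext

theorem overlapBound_exchange_recv {d : (Fin (k + 1) → Fin 2) → ℝ} (hK : 0 ≤ K) (hd : 0 ≤ d)
    (h : (exchange hne finish j (k + 1) true).OverlapBound a w K d) :
    (exchange hne finish (j + 1) k false).OverlapBound a w K (rmsLast (a (k + 1)) d) := by
  intro ρ _ σ hσ hσρ
  obtain ⟨ρ', hρ', hmarginal, hmap⟩ :=
    map_receiveHalf (U := unsent j true) (trace_pureState_unsentState a j true (k + 1)) hσ hσρ _
  refine (congrArg (Strategy.OutcomeLE w _ (exchange hne finish j (k + 1) true)) hmap).mpr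
    ((h ρ' hρ').mono ?_)
  have hoverlap := overlap_nonneg a hd (diagProb ρ')
  gcongr
  exact overlap_le_of_cheat a d (diagProb_nonneg hρ') hmarginal

theorem overlapBound_exchange_zero {n : ℕ} (hK : 0 ≤ K) :
    ∀ {k j : ℕ} {d : (Fin k → Fin 2) → ℝ}, k + j = n → 0 ≤ d →
      (exchange hne finish j k (decide (sender (k + 1) = me))).OverlapBound a w K d →
      (exchange hne finish n 0 (decide (sender 1 = me))).OverlapBound a w K
        fun _ => nested a me k d := by
  intro k
  induction k with
  | zero =>
    rintro j d hj - h
    obtain rfl : j = n := by omega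
    convert h using 2 with x
    rw [nested, Subsingleton.elim x Fin.elim0]
  | succ k ih =>
    intro j d hj hd h
    rw [nested]
    refine ih (j := j + 1) (by omega) ?_ ?_
    · split_ifs
      exacts [traceLast_nonneg _ hd, rmsLast_nonneg _ d]
    · have hsucc := sender_succ (k + 1)
      split_ifs with hs
      · rw [hsucc, hs, decide_eq_false (by cases me <;> decide)] at h
        rw [decide_eq_true hs]
        exact overlapBound_exchange_send h
      · have hs' : (sender (k + 1)).other = me := Player.eq_of_ne (r := sender (k + 1)) (by
          cases sender (k + 1) <;> decide) (Ne.symm hs)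
        rw [hsucc, decide_eq_true hs'] at h
        rw [decide_eq_false hs]
        exact overlapBound_exchange_recv hK hd h

end Exchange

theorem norm_apply_le_sqrt_mul_sqrt {α : Type} {R : Matrix α α ℂ} (hR : R.PosSemidef) (p q : α) :
    ‖R p q‖ ≤ √(diagProb R p) * √(diagProb R q) := by
  have hdet := (hR.submatrix ![p, q]).det_nonneg
  have hp : R p p = diagProb R p := Complex.eq_re_of_ofReal_le hR.diag_nonneg
  have hq : R q q = diagProb R q := Complex.eq_re_of_ofReal_le hR.diag_nonneg
  rw [← Real.sqrt_mul (diagProb_nonneg hR p)]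
  refine Real.le_sqrt_of_sq_le ?_
  simp only [Matrix.det_fin_two, Matrix.submatrix_apply, Matrix.cons_val_zero,
    Matrix.cons_val_one] at hdet
  rw [← hR.1.apply q p, RCLike.star_def, Complex.mul_conj, Complex.normSq_eq_norm_sq, hp, hq]
    at hdet
  exact sub_nonneg.1 (mod_cast hdet)

theorem trace_lineProj_mul_re_le {α : Type} [Fintype α] (v : α → ℂ) {R : Matrix α α ℂ}
    (hR : R.PosSemidef) :
    (lineProj v * R).trace.re ≤ (∑ p, ‖v p‖ ^ 2)⁻¹ * (∑ p, ‖v p‖ * √(diagProb R p)) ^ 2 := by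
  have hnorm : v ⬝ᵥ star v = ((∑ p, ‖v p‖ ^ 2 : ℝ) : ℂ) := by
    simp only [dotProduct, Pi.star_apply, RCLike.star_def, Complex.mul_conj,
      Complex.normSq_eq_norm_sq, Complex.ofReal_sum]
  have htrace : (lineProj v * R).trace =
      ((∑ p, ‖v p‖ ^ 2)⁻¹ : ℝ) * ∑ p, ∑ q, v p * (star (v q) * R q p) := by
    rw [lineProj, Matrix.smul_mul, Matrix.trace_smul, smul_eq_mul, hnorm, Complex.ofReal_inv]
    simp only [Matrix.trace, Matrix.diag, Matrix.mul_apply, Matrix.vecMulVec_apply,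
      Pi.star_apply, mul_assoc]
  rw [htrace, Complex.re_ofReal_mul]
  refine mul_le_mul_of_nonneg_left ?_ (by positivity)
  calc (∑ p, ∑ q, v p * (star (v q) * R q p)).re
      ≤ ‖∑ p, ∑ q, v p * (star (v q) * R q p)‖ := Complex.re_le_norm _
    _ ≤ ∑ p, ∑ q, ‖v p‖ * (‖v q‖ * (√(diagProb R q) * √(diagProb R p))) := by
        refine norm_sum_le_of_le _ fun p _ => norm_sum_le_of_le _ fun q _ => ?_
        rw [norm_mul, norm_mul, norm_star]
        gcongr
        exact norm_apply_le_sqrt_mul_sqrt hR q p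
    _ = (∑ p, ‖v p‖ * √(diagProb R p)) ^ 2 := by
        rw [sq, Finset.sum_mul_sum]
        exact Finset.sum_congr rfl fun p _ => Finset.sum_congr rfl fun q _ => by ring

theorem diagProb_le_diagProb_traceRight {α β : Type} [Fintype β]
    {σ : Matrix (α × β) (α × β) ℂ} (hσ : σ.PosSemidef) (x : α) (y : β) :
    diagProb σ (x, y) ≤ diagProb (traceRight σ) x := by
  rw [diagProb, diagProb, traceRight_apply, Complex.re_sum]
  exact Finset.single_le_sum (f := fun y => (σ (x, y) (x, y)).re)
    (fun _ _ => diagProb_nonneg hσ _) (Finset.mem_univ y)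

theorem psi_apply (a : ℕ → unitInterval) (n : ℕ) (x y : Fin n → Fin 2) :
    psi a n (x, y) = if x = y then ((√(stringProb a n x) : ℝ) : ℂ) else 0 := by
  simp only [psi, phi_apply]
  split_ifs with h
  · subst h
    simp only [if_true, stringProb]
    rw [Real.sqrt_prod _ fun i _ => bitProb_nonneg _ _, Complex.ofReal_prod]
  · obtain ⟨i, hi⟩ := Function.ne_iff.1 h
    exact Finset.prod_eq_zero (Finset.mem_univ i) (if_neg hi)

/-- The probability that the player `w` wins when both players are honest. -/
def winProb (a : ℕ → unitInterval) (w : Player) (n : ℕ) : ℝ := ∑ x, E w n x * stringProb a n x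

theorem E_nonneg (w : Player) (n : ℕ) : 0 ≤ E w n := fun x => by
  unfold E
  split_ifs <;> simp

theorem E_mul_self (w : Player) (n : ℕ) (x : Fin n → Fin 2) : E w n x * E w n x = E w n x := by
  unfold E
  split_ifs <;> simp

theorem winProb_nonneg (a : ℕ → unitInterval) (w : Player) (n : ℕ) : 0 ≤ winProb a w n :=
  Finset.sum_nonneg fun x _ => mul_nonneg (E_nonneg w n x) (stringProb_nonneg a n x)

/-- The labels of the memory of a player at the final measurement: the player's own qubits and the
opponent's message. -/
abbrev CheckMem (n : ℕ) : Type := Option (Fin n → Fin 2) × Option (Fin n → Fin 2)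

section

variable (a : ℕ → unitInterval) (w : Player) (n : ℕ)

theorem norm_checkVecMem_some (x y : Fin n → Fin 2) :
    ‖checkVecMem a w n ((some x, some y) : CheckMem n)‖ =
      if x = y then E w n x * √(stringProb a n x) else 0 := by
  change ‖(E w n x : ℂ) * E w n y * psi a n (x, y)‖ = _
  rw [psi_apply]
  split_ifs with h
  · subst h
    rw [← Complex.ofReal_mul, ← Complex.ofReal_mul, E_mul_self, Complex.norm_real,
      Real.norm_of_nonneg (mul_nonneg (E_nonneg w n x) (Real.sqrt_nonneg _))]
  · simp

theorem sum_norm_checkVecMem_mul (g : CheckMem n → ℝ) :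
    ∑ p : CheckMem n, ‖checkVecMem a w n p‖ * g p =
      ∑ x, E w n x * √(stringProb a n x) * g (some x, some x) := by
  have hleft (y : Option (Fin n → Fin 2)) : checkVecMem a w n ((none, y) : CheckMem n) = 0 := rfl
  have hright (x : Fin n → Fin 2) : checkVecMem a w n ((some x, none) : CheckMem n) = 0 := rfl
  simp [Fintype.sum_prod_type, Fintype.sum_option, hleft, hright, norm_checkVecMem_some]

theorem sum_norm_checkVecMem_sq :
    ∑ p : CheckMem n, ‖checkVecMem a w n p‖ ^ 2 = winProb a w n := by
  simp only [sq]
  rw [sum_norm_checkVecMem_mul, winProb]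
  refine Finset.sum_congr rfl fun x _ => ?_
  rw [norm_checkVecMem_some, if_pos rfl, mul_mul_mul_comm, E_mul_self,
    Real.mul_self_sqrt (stringProb_nonneg a n x)]

theorem trace_finalMeasurement_le {R : Matrix (CheckMem n) (CheckMem n) ℂ} (hR : R.PosSemidef)
    {t : (Fin n → Fin 2) → ℝ} (ht : ∀ x, winner n x = w → diagProb R (some x, some x) ≤ t x) :
    ((finalMeasurement a w n).proj w * R).trace.re ≤
      (winProb a w n)⁻¹ * overlap a n (E w n) t ^ 2 := by
  have hproj : (finalMeasurement a w n).proj w = lineProj (checkVecMem a w n) := if_pos rfl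
  have hsum : ∑ x, E w n x * √(stringProb a n x) * √(diagProb R (some x, some x)) ≤
      overlap a n (E w n) t := by
    refine Finset.sum_le_sum fun x _ => ?_
    rw [mul_assoc]
    by_cases hx : winner n x = w
    · have := E_nonneg w n x
      gcongr
      exact ht x hx
    · simp [E, hx]
  rw [hproj]
  refine (trace_lineProj_mul_re_le _ hR).trans ?_
  rw [sum_norm_checkVecMem_sq, sum_norm_checkVecMem_mul]
  refine mul_le_mul_of_nonneg_left (pow_le_pow_left₀ ?_ hsum 2)
    (inv_nonneg.2 (winProb_nonneg a w n))
  exact Finset.sum_nonneg fun x _ =>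
    mul_nonneg (mul_nonneg (E_nonneg w n x) (Real.sqrt_nonneg _)) (Real.sqrt_nonneg _)

end

theorem kronecker_pureState_unsentState_zero (a : ℕ → unitInterval) {n : ℕ} (mine : Bool)
    (ρ : Matrix (Fin n → Fin 2) (Fin n → Fin 2) ℂ) (p q : (Fin n → Fin 2) × Unit) :
    (ρ ⊗ₖ pureState (unsentState a 0 mine n)) p q = ρ p.1 q.1 := by
  change ρ p.1 q.1 * (1 * star 1) = ρ p.1 q.1
  simp

theorem overlapBound_aliceFinish (a : ℕ → unitInterval) (n : ℕ) (mine : Bool) :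
    (aliceFinish a n mine).OverlapBound a .bob (winProb a .bob n)⁻¹ (E .bob n) := by
  rintro ρ - σ hσ hσρ
  change ((finalMeasurement a .bob n).proj .bob *
    (Channel.ofInjective (id : CheckMem n → CheckMem n) Function.injective_id).map σ).trace.re ≤ _
  rw [Channel.ofInjective_map (g := id) _ fun _ => rfl, Matrix.submatrix_id_id]
  refine trace_finalMeasurement_le a .bob n hσ fun x hx =>
    (diagProb_le_diagProb_traceRight hσ _ _).trans_eq (congrArg Complex.re ?_)
  rw [hσρ]
  exact (Channel.traceRight_measureMap_map_apply_of_fiber (x := (x, ())) _ _ _ _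
    (by rintro ⟨y, _⟩; dsimp only; split_ifs <;> grind)).trans
      (kronecker_pureState_unsentState_zero a mine ρ _ _)

theorem overlapBound_bobFinish (a : ℕ → unitInterval) (n : ℕ) (mine : Bool) :
    (bobFinish a n mine).OverlapBound a .alice (winProb a .alice n)⁻¹ (E .alice n) := by
  rintro ρ - (σ : Matrix (((Fin n → Fin 2) × Unit) × Option (Fin n → Fin 2))
    (((Fin n → Fin 2) × Unit) × Option (Fin n → Fin 2)) ℂ) hσ hσρ
  have hid : (Channel.ofInjective id Function.injective_id).map σ = σ := by
    rw [Channel.ofInjective_map (g := id) _ fun _ => rfl, Matrix.submatrix_id_id]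
  refine (congrArg (Strategy.OutcomeLE .alice _ (.send _ _ _)) hid).mpr ?_
  refine trace_finalMeasurement_le a .alice n
    (posSemidef_traceRight (Channel.posSemidef_map _ hσ)) fun x hx => ?_
  calc _ = diagProb σ ((x, ()), some x) :=
        congrArg Complex.re (Channel.traceRight_measureMap_map_apply_of_fiber _ _ _ _
          (by rintro ⟨⟨y, _⟩, z⟩; dsimp only; split_ifs <;> grind))
    _ ≤ diagProb (traceRight σ) (x, ()) := diagProb_le_diagProb_traceRight hσ _ _
    _ = diagProb ρ x :=
        (congrArg (fun τ => diagProb τ (x, ())) hσρ).trans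
          (congrArg Complex.re (kronecker_pureState_unsentState_zero a mine ρ _ _))

theorem pureState_snd {α β : Type} [Subsingleton α] [DecidableEq α] (χ : β → ℂ) :
    pureState (fun p : α × β => χ p.2) = (1 : Matrix α α ℂ) ⊗ₖ pureState χ := by
  ext p q
  rw [Matrix.kroneckerMap_apply, Subsingleton.elim q.1 p.1, Matrix.one_apply_eq, one_mul,
    pureState_apply, pureState_apply]

section CheatingBounds

variable {me opp w : Player} {hne : opp ≠ me}
  {finish : ∀ (k : ℕ) (mine : Bool), Strategy me (messagesFrom .alice .bob k 0) (stage k 0 mine)}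
  {a : ℕ → unitInterval} {K : ℝ} {n : ℕ}

theorem outcomeLE_honest {d : (Fin n → Fin 2) → ℝ} (hK : 0 ≤ K) (hd : 0 ≤ d)
    (hfinish : ∀ mine, (finish n mine).OverlapBound a w K d) {mine : Bool}
    (hmine : decide (sender 1 = me) = mine) :
    (exchange hne finish n 0 mine).OutcomeLE w (K * nested a me n d ^ 2)
      (honest a n mine (exchange hne finish n 0 mine)).init := by
  subst hmine
  have h := overlapBound_exchange_zero (hne := hne) hK (j := 0) rfl hd (hfinish _) 1 .one
  refine (congrArg (Strategy.OutcomeLE w _ (exchange hne finish n 0 _))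
    (pureState_snd (α := Fin 0 → Fin 2) _)).mpr (h.mono (le_of_eq ?_))
  simp [overlap, stringProb, diagProb]

end CheatingBounds

theorem cheatAlice_protocol_le (n : ℕ) (a : ℕ → unitInterval) :
    (protocol n a).cheatAlice ≤ (winProb a .alice n)⁻¹ * nested a .bob n (E .alice n) ^ 2 := by
  have hwin := winProb_nonneg a .alice n
  refine Real.sSup_le ?_ (by positivity)
  rintro _ ⟨A, rfl⟩
  refine Strategy.OutcomeLE.sum_run_left_le ?_
    (A.posSemidef.kronecker (protocol n a).bob.posSemidef) A.strategy
  rw [traceLeft_kronecker, A.trace_eq_one, one_smul]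
  exact outcomeLE_honest (inv_nonneg.2 hwin) (E_nonneg .alice n)
    (overlapBound_bobFinish a n) (by decide)

theorem cheatBob_protocol_le (n : ℕ) (a : ℕ → unitInterval) :
    (protocol n a).cheatBob ≤ (winProb a .bob n)⁻¹ * nested a .alice n (E .bob n) ^ 2 := by
  have hwin := winProb_nonneg a .bob n
  refine Real.sSup_le ?_ (by positivity)
  rintro _ ⟨B, rfl⟩
  refine Strategy.OutcomeLE.sum_run_right_le ?_
    ((protocol n a).alice.posSemidef.kronecker B.posSemidef) B.strategy
  rw [traceRight_kronecker, B.trace_eq_one, one_smul]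
  exact outcomeLE_honest (inv_nonneg.2 hwin) (E_nonneg .bob n)
    (overlapBound_aliceFinish a n) (by decide)

section Linearity

variable {α β γ m ι : Type}

theorem passRight_sum (s : Finset ι) (ρ : ι → Matrix ((α × m) × β) ((α × m) × β) ℂ) :
    passRight (∑ i ∈ s, ρ i) = ∑ i ∈ s, passRight (ρ i) := by
  ext p q
  simp [passRight, Matrix.sum_apply]

theorem passLeft_sum (s : Finset ι) (ρ : ι → Matrix (α × (β × m)) (α × (β × m)) ℂ) :
    passLeft (∑ i ∈ s, ρ i) = ∑ i ∈ s, passLeft (ρ i) := by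
  ext p q
  simp [passLeft, Matrix.sum_apply]

theorem Channel.onRight_sum [Fintype α] [DecidableEq α] [Fintype β] [Fintype γ] [DecidableEq γ]
    (C : Channel α β) (s : Finset ι) (ρ : ι → Matrix (γ × α) (γ × α) ℂ) :
    C.onRight (∑ i ∈ s, ρ i) = ∑ i ∈ s, C.onRight (ρ i) := by
  simp only [Channel.onRight, Matrix.mul_sum, Matrix.sum_mul]
  exact Finset.sum_comm

end Linearity

section Branches

theorem mul_pureState_mul_conjTranspose {α β : Type} [Fintype α] (K : Matrix β α ℂ) (Ψ : α → ℂ) :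
    K * pureState Ψ * Kᴴ = pureState (K *ᵥ Ψ) := by
  rw [pureState, pureState, Matrix.mul_vecMulVec, Matrix.vecMulVec_mul, ← Matrix.star_mulVec]

variable {α β γ δ m m' ω : Type} [Fintype α] [DecidableEq α] [Fintype β] [DecidableEq β]
  [Fintype γ] [DecidableEq γ] [Fintype δ] [DecidableEq δ] [Fintype m] [DecidableEq m]
  [Fintype m'] [DecidableEq m'] [Fintype ω] [DecidableEq ω]

theorem Channel.measureMap_onLeft_pureState {o : α → ω} {f : α → β}
    (hf : ∀ x x', o x = o x' → f x = f x' → x = x') (Ψ : α × γ → ℂ) :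
    (Channel.measureMap o f hf).onLeft (pureState Ψ) =
      ∑ w, pureState fun p => ∑ x, if o x = w ∧ p.1 = f x then Ψ (x, p.2) else 0 := by
  refine Finset.sum_congr rfl fun (w : ω) _ => ?_
  rw [mul_pureState_mul_conjTranspose]
  congr 1
  ext p
  simp [measureMap, Matrix.mulVec, dotProduct, Fintype.sum_prod_type, Matrix.one_apply]

theorem Channel.measureMap_onRight_pureState {o : α → ω} {f : α → β}
    (hf : ∀ x x', o x = o x' → f x = f x' → x = x') (Ψ : γ × α → ℂ) :
    (Channel.measureMap o f hf).onRight (pureState Ψ) =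
      ∑ w, pureState fun p => ∑ x, if o x = w ∧ p.2 = f x then Ψ (p.1, x) else 0 := by
  refine Finset.sum_congr rfl fun (w : ω) _ => ?_
  rw [mul_pureState_mul_conjTranspose]
  congr 1
  ext p
  refine (Fintype.sum_prod_type_right _).trans (Finset.sum_congr rfl fun x _ => ?_)
  split_ifs with h <;> simp [measureMap, Matrix.one_apply, h]

theorem passLeft_measureMap_onRight_passRight_measureMap_onLeft_pureState
    {o : α → ω} {f : α → β × m} (hf : ∀ x x', o x = o x' → f x = f x' → x = x')
    {o' : γ × m → ω} {f' : γ × m → δ × m'} (hf' : ∀ z z', o' z = o' z' → f' z = f' z' → z = z')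
    (Ψ : α × γ → ℂ) :
    passLeft ((Channel.measureMap o' f' hf').onRight
      (passRight ((Channel.measureMap o f hf).onLeft (pureState Ψ)))) =
      ∑ w, ∑ w', pureState fun p : (β × m') × δ =>
        ∑ z, if o' z = w' ∧ (p.2, p.1.2) = f' z then
          ∑ x, if o x = w ∧ (p.1.1, z.2) = f x then Ψ (x, z.1) else 0
        else 0 := by
  rw [Channel.measureMap_onLeft_pureState, passRight_sum, Channel.onRight_sum, passLeft_sum]
  refine Finset.sum_congr rfl fun w _ => ?_
  refine (congrArg passLeft (Channel.measureMap_onRight_pureState hf' fun p : β × (γ × m) =>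
    ∑ x, if o x = w ∧ (p.1, p.2.2) = f x then Ψ (x, p.2.1) else 0)).trans ?_
  rw [passLeft_sum]
  rfl

end Branches

theorem lineProj_mul_pureState_self {α : Type} [Fintype α] (v : α → ℂ) :
    lineProj v * pureState v = pureState v := by
  rw [lineProj, pureState, Matrix.smul_mul, Matrix.vecMulVec_mul_vecMulVec,
    dotProduct_comm (star v) v, Matrix.vecMulVec_smul, smul_smul]
  by_cases h : v ⬝ᵥ star v = 0
  · rw [dotProduct_self_star_eq_zero.1 h]
    simp
  · rw [inv_mul_cancel₀ h, one_smul]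

theorem lineProj_mul_pureState_eq_zero {α : Type} [Fintype α] {u v : α → ℂ}
    (h : star v ⬝ᵥ u = 0) : lineProj v * pureState u = 0 := by
  rw [lineProj, pureState, Matrix.smul_mul, Matrix.vecMulVec_mul_vecMulVec, h, zero_smul]
  simp

section HonestCheck

variable (a : ℕ → unitInterval) (n : ℕ)

/-- The label of the memory in which a player has sent its qubits away and received nothing. -/
def noQubits : CheckMem n := (none, none)

theorem trace_finalMeasurement_mul_pureState_checkVecMem (w w' : Player) :
    ((finalMeasurement a w n).proj w' * pureState (checkVecMem a w n)).trace =
      if w' = w then (winProb a w n : ℂ) else 0 := by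
  simp only [finalMeasurement]
  split_ifs
  · rw [lineProj_mul_pureState_self, trace_pureState, ← sum_norm_checkVecMem_sq]
    simp [Complex.mul_conj, Complex.normSq_eq_norm_sq]
  · rw [sub_mul, lineProj_mul_pureState_self, one_mul, sub_self, Matrix.trace_zero]

theorem trace_finalMeasurement_mul_pureState_noQubits (w w' : Player) :
    ((finalMeasurement a w n).proj w' * pureState (Pi.single (noQubits n) 1)).trace =
      if w' = w then 0 else 1 := by
  have horth : star (checkVecMem a w n) ⬝ᵥ Pi.single (noQubits n) (1 : ℂ) = 0 := by
    rw [dotProduct_single, mul_one, Pi.star_apply]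
    exact star_zero ℂ
  simp only [finalMeasurement]
  split_ifs
  · rw [lineProj_mul_pureState_eq_zero horth, Matrix.trace_zero]
  · rw [sub_mul, lineProj_mul_pureState_eq_zero horth, one_mul, sub_zero, trace_pureState]
    simp [Pi.single_apply]

/-- The unnormalized joint memory of two honest players at the final measurement, in the branch
where both have found the winner `w`: the loser holds `(E_w ⊗ E_w) ψ`, the winner holds nothing. -/
def checkBranch : Player → CheckMem n × CheckMem n → ℂ
  | .alice => fun p => (Pi.single (noQubits n) 1 : CheckMem n → ℂ) p.1 * checkVecMem a .alice n p.2
  | .bob => fun p => checkVecMem a .bob n p.1 * (Pi.single (noQubits n) 1 : CheckMem n → ℂ) p.2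

theorem trace_finalMeasurement_mul_pureState_checkBranch (w x y : Player) :
    (((finalMeasurement a .bob n).proj x ⊗ₖ (finalMeasurement a .alice n).proj y) *
      pureState (checkBranch a n w)).trace =
      if x = w ∧ y = w then (winProb a w n : ℂ) else 0 := by
  cases w <;>
  · rw [checkBranch, pureState_kronecker, ← Matrix.mul_kronecker_mul, Matrix.trace_kronecker,
      trace_finalMeasurement_mul_pureState_noQubits,
      trace_finalMeasurement_mul_pureState_checkVecMem]
    cases x <;> cases y <;> simp

/-- The labels of Alice's kept register and of her message after she has measured the winner. -/
def aliceSplit (p : qubits n × Unit) : qubitsOrNothing n × qubitsOrNothing n :=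
  if winner n p.1 = .alice then (none, some p.1) else (some p.1, none)

/-- The labels of Bob's kept register and of his message after he has measured the winner. -/
def bobSplit (p : (qubits n × Unit) × qubitsOrNothing n) :
    (qubitsOrNothing n × qubitsOrNothing n) × qubitsOrNothing n :=
  if winner n p.1.1 = .bob then ((none, p.2), some p.1.1) else ((some p.1.1, p.2), none)

theorem checkVecMem_eq_sum (w : Player) (p : CheckMem n) :
    checkVecMem a w n p = ∑ y, if winner n y = w ∧ p = (some y, some y) then
      ((√(stringProb a n y) : ℝ) : ℂ) else 0 := by
  obtain ⟨_ | x, _ | y⟩ := p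
  · simp [checkVecMem]
  · simp [checkVecMem]
  · simp [checkVecMem]
  · rw [Finset.sum_eq_single y (fun z _ hz => by simp [hz.symm]) (by simp)]
    change (E w n x : ℂ) * E w n y * psi a n (x, y) = _
    rw [psi_apply]
    by_cases hxy : x = y <;> by_cases hy : winner n y = w <;> simp [E, hxy, hy]

theorem sum_aliceSplit (w : Player) (y : Fin n → Fin 2)
    (p : qubitsOrNothing n × qubitsOrNothing n) :
    (∑ x : (Fin n → Fin 2) × Unit,
      if winner n x.1 = w ∧ p = aliceSplit n x then psi a n (x.1, y) else 0) =
      if winner n y = w ∧ p = aliceSplit n (y, ()) then ((√(stringProb a n y) : ℝ) : ℂ) else 0 := by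
  rw [Fintype.sum_eq_single (y, ())]
  · rw [psi_apply, if_pos rfl]
  · rintro ⟨x, _⟩ hx
    rw [psi_apply, if_neg fun h => hx (Prod.ext h rfl), ite_self]

theorem sum_bobSplit_aliceSplit (w w' : Player) (p : CheckMem n × CheckMem n) :
    (∑ z : ((Fin n → Fin 2) × Unit) × Option (Fin n → Fin 2),
      if winner n z.1.1 = w' ∧ (p.2, p.1.2) = bobSplit n z then
        ∑ x : (Fin n → Fin 2) × Unit,
          if winner n x.1 = w ∧ (p.1.1, z.2) = aliceSplit n x then psi a n (x.1, z.1.1) else 0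
      else 0) = if w = w' then checkBranch a n w p else 0 := by
  obtain ⟨⟨o, m⟩, o', m'⟩ := p
  simp only [sum_aliceSplit]
  rw [Fintype.sum_prod_type, Fintype.sum_prod_type]
  simp only [Fintype.sum_unique]
  by_cases hw : w = w'
  · subst hw
    rw [if_pos rfl]
    cases w <;> simp only [checkBranch, checkVecMem_eq_sum, Finset.mul_sum, Finset.sum_mul]
    all_goals
      refine Finset.sum_congr rfl fun y _ => ?_
      rw [Fintype.sum_eq_single m']
      · unfold aliceSplit bobSplit noQubits
        simp only [Pi.single_apply]
        grind
      · intro c hc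
        unfold bobSplit
        grind
  · rw [if_neg hw]
    refine Finset.sum_eq_zero fun y _ => Finset.sum_eq_zero fun c _ => ?_
    grind

theorem aliceSplit_injective : Function.Injective (aliceSplit n) := by
  rintro ⟨x, _⟩ ⟨x', _⟩ h
  unfold aliceSplit at h
  grind

theorem bobSplit_injective : Function.Injective (bobSplit n) := by
  rintro ⟨⟨x, _⟩, m⟩ ⟨⟨x', _⟩, m'⟩ h
  unfold bobSplit at h
  grind

theorem run_finish (mine mine' : Bool) (x y : Player) :
    run _ (aliceFinish a n mine) (bobFinish a n mine')
      (pureState fun p : (qubits n × Unit) × (qubits n × Unit) => psi a n (p.1.1, p.2.1)) x y =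
      if x = y then winProb a x n else 0 := by
  change ((((finalMeasurement a .bob n).proj x ⊗ₖ (finalMeasurement a .alice n).proj y) *
    ((Channel.ofInjective (id : CheckMem n → CheckMem n) Function.injective_id).onLeft (passLeft
      ((Channel.measureMap (fun p => winner n p.1.1) (bobSplit n)
        fun _ _ _ h => bobSplit_injective n h).onRight
        ((Channel.ofInjective (id : ((Fin n → Fin 2) × Unit) × Option (Fin n → Fin 2) → _)
          Function.injective_id).onRight (passRight
            ((Channel.measureMap (fun p => winner n p.1) (aliceSplit n)
              fun _ _ _ h => aliceSplit_injective n h).onLeft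
                (pureState fun p : ((Fin n → Fin 2) × Unit) × ((Fin n → Fin 2) × Unit) =>
                  psi a n (p.1.1, p.2.1))))))))).trace).re = _
  have hzero : pureState (fun _ : CheckMem n × CheckMem n => (0 : ℂ)) = 0 := by
    ext p q
    simp [pureState_apply]
  rw [Channel.ofInjective_onLeft _ (g := id) fun _ => rfl,
    Channel.ofInjective_onRight _ (g := id) fun _ => rfl, Prod.map_id, Matrix.submatrix_id_id,
    Prod.map_id, Matrix.submatrix_id_id,
    passLeft_measureMap_onRight_passRight_measureMap_onLeft_pureState]
  simp only [sum_bobSplit_aliceSplit, sum_player, if_true, reduceCtorEq, if_false, hzero, add_zero,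
    zero_add]
  rw [mul_add, Matrix.trace_add, trace_finalMeasurement_mul_pureState_checkBranch,
    trace_finalMeasurement_mul_pureState_checkBranch]
  cases x <;> cases y <;> simp

end HonestCheck

section HonestExchange

variable {β γ : Type} [Fintype β] [DecidableEq β] [Fintype γ] [DecidableEq γ] {k : ℕ}

theorem onRight_passRight_onLeft_pureState
    {f : (Fin k → Fin 2) × ((Fin 2 × Fin 2) × β) → ((Fin (k + 1) → Fin 2) × β) × Fin 2}
    (hf : f.Injective) (hf' : ∀ p, f p = ((Fin.snoc p.1 p.2.1.1, p.2.2), p.2.1.2))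
    {g : ((Fin k → Fin 2) × γ) × Fin 2 → (Fin (k + 1) → Fin 2) × γ}
    (hg : g.Injective) (hg' : ∀ p, g p = (Fin.snoc p.1.1 p.2, p.1.2))
    (Φ : ((Fin k → Fin 2) × ((Fin 2 × Fin 2) × β)) × ((Fin k → Fin 2) × γ) → ℂ) :
    (Channel.ofInjective g hg).onRight (passRight
      ((Channel.ofInjective f hf).onLeft (pureState Φ))) =
      pureState fun p : ((Fin (k + 1) → Fin 2) × β) × ((Fin (k + 1) → Fin 2) × γ) =>
        Φ ((Fin.init p.1.1, (p.1.1 (Fin.last k), p.2.1 (Fin.last k)), p.1.2),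
          (Fin.init p.2.1, p.2.2)) := by
  rw [Channel.ofInjective_onLeft hf
      (g := fun p => (Fin.init p.1.1, (p.1.1 (Fin.last k), p.2), p.1.2))
      fun p => by simp [hf'],
    Channel.ofInjective_onRight hg (g := fun p => ((Fin.init p.1, p.2), p.1 (Fin.last k)))
      fun p => by simp [hg']]
  rfl

theorem onLeft_passLeft_onRight_pureState
    {f : (Fin k → Fin 2) × ((Fin 2 × Fin 2) × β) → ((Fin (k + 1) → Fin 2) × β) × Fin 2}
    (hf : f.Injective) (hf' : ∀ p, f p = ((Fin.snoc p.1 p.2.1.1, p.2.2), p.2.1.2))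
    {g : ((Fin k → Fin 2) × γ) × Fin 2 → (Fin (k + 1) → Fin 2) × γ}
    (hg : g.Injective) (hg' : ∀ p, g p = (Fin.snoc p.1.1 p.2, p.1.2))
    (Φ : ((Fin k → Fin 2) × γ) × ((Fin k → Fin 2) × ((Fin 2 × Fin 2) × β)) → ℂ) :
    (Channel.ofInjective g hg).onLeft (passLeft
      ((Channel.ofInjective f hf).onRight (pureState Φ))) =
      pureState fun p : ((Fin (k + 1) → Fin 2) × γ) × ((Fin (k + 1) → Fin 2) × β) =>
        Φ ((Fin.init p.1.1, p.1.2),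
          (Fin.init p.2.1, (p.2.1 (Fin.last k), p.1.1 (Fin.last k)), p.2.2)) := by
  rw [Channel.ofInjective_onRight hf
      (g := fun p => (Fin.init p.1.1, (p.1.1 (Fin.last k), p.2), p.1.2))
      fun p => by simp [hf'],
    Channel.ofInjective_onLeft hg (g := fun p => ((Fin.init p.1, p.2), p.1 (Fin.last k)))
      fun p => by simp [hg']]
  rfl

end HonestExchange

theorem run_send_recv {s : Player} {m : Register} {l : List Message}
    {α α' β β' : Register} (hs : s = .alice) (C : Channel α (α' × m)) (A : Strategy .alice l α')
    (hs' : s ≠ .bob) (D : Channel (β × m) β') (B : Strategy .bob l β')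
    (ρ : Matrix (α × β) (α × β) ℂ) (x y : Player) :
    run (⟨s, m⟩ :: l) (.send hs C A) (.recv hs' D B) ρ x y =
      run l A B (D.onRight (passRight (C.onLeft ρ))) x y := by
  simp only [run]

theorem run_recv_send {s : Player} {m : Register} {l : List Message}
    {α α' β β' : Register} (hs : s ≠ .alice) (C : Channel (α × m) α') (A : Strategy .alice l α')
    (hs' : s = .bob) (D : Channel β (β' × m)) (B : Strategy .bob l β')
    (ρ : Matrix (α × β) (α × β) ℂ) (x y : Player) :
    run (⟨s, m⟩ :: l) (.recv hs C A) (.send hs' D B) ρ x y =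
      run l A B (C.onLeft (passLeft (D.onRight ρ))) x y := by
  simp only [run]

theorem phi_comm (a : unitInterval) (b c : Fin 2) : phi a (b, c) = phi a (c, b) := by
  rw [phi_apply, phi_apply]
  by_cases h : b = c
  · rw [h]
  · rw [if_neg h, if_neg (Ne.symm h)]

section HonestRun

variable (a : ℕ → unitInterval) (j k : ℕ)

theorem psi_succ (x y : Fin (k + 1) → Fin 2) :
    psi a (k + 1) (x, y) =
      psi a k (Fin.init x, Fin.init y) * phi (a (k + 1)) (x (Fin.last k), y (Fin.last k)) := by
  simp [psi, Fin.prod_univ_castSucc, Fin.init]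

/-- The amplitudes of the joint state of two honest players during the exchange. -/
def honestState (b b' : Bool)
    (p : ((Fin k → Fin 2) × unsent j b) × ((Fin k → Fin 2) × unsent j b')) : ℂ :=
  psi a k (p.1.1, p.2.1) * (unsentState a j b k p.1.2 * unsentState a j b' k p.2.2)

theorem run_exchange_zero (b b' : Bool) (x y : Player) :
    run _ (aliceFinish a k b) (bobFinish a k b') (pureState (honestState a 0 k b b')) x y =
      if x = y then winProb a x k else 0 := by
  have h : pureState (honestState a 0 k b b') =
      pureState fun p : ((Fin k → Fin 2) × Unit) × ((Fin k → Fin 2) × Unit) =>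
        psi a k (p.1.1, p.2.1) := by
    congr 1
    ext p
    change _ * ((1 : ℂ) * 1) = _
    rw [one_mul, mul_one]
  exact (congrArg (fun σ => run _ (aliceFinish a k b) (bobFinish a k b') σ x y) h).trans
    (run_finish a k b b' x y)

theorem run_exchange_alice_sends (x y : Player) :
    run _ (exchange (opp := .bob) (by decide) (aliceFinish a) (j + 1) k true)
        (exchange (opp := .alice) (by decide) (bobFinish a) (j + 1) k false)
        (pureState (honestState a (j + 1) k true false)) x y =
      run _ (exchange (opp := .bob) (by decide) (aliceFinish a) j (k + 1) false)
        (exchange (opp := .alice) (by decide) (bobFinish a) j (k + 1) true)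
        (pureState (honestState a j (k + 1) false true)) x y := by
  refine (run_send_recv rfl _ _ _ _ _ _ x y).trans (congrArg (fun σ => run _ _ _ σ x y) ?_)
  refine (onRight_passRight_onLeft_pureState (β := unsent j false) (γ := unsent j true) _
    (fun _ => rfl) _ (fun _ => rfl) _).trans (congrArg pureState ?_)
  ext p
  change psi a k _ * ((phi _ _ * unsentState a j false (k + 1) p.1.2) *
    unsentState a j true (k + 1) p.2.2) = psi a (k + 1) _ * _
  rw [psi_succ]
  ring

theorem run_exchange_bob_sends (x y : Player) :
    run _ (exchange (opp := .bob) (by decide) (aliceFinish a) (j + 1) k false)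
        (exchange (opp := .alice) (by decide) (bobFinish a) (j + 1) k true)
        (pureState (honestState a (j + 1) k false true)) x y =
      run _ (exchange (opp := .bob) (by decide) (aliceFinish a) j (k + 1) true)
        (exchange (opp := .alice) (by decide) (bobFinish a) j (k + 1) false)
        (pureState (honestState a j (k + 1) true false)) x y := by
  refine (run_recv_send _ _ _ rfl _ _ _ x y).trans (congrArg (fun σ => run _ _ _ σ x y) ?_)
  refine (onLeft_passLeft_onRight_pureState (β := unsent j false) (γ := unsent j true) _
    (fun _ => rfl) _ (fun _ => rfl) _).trans (congrArg pureState ?_)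
  ext p
  change psi a k _ * (unsentState a j true (k + 1) p.1.2 *
    (phi _ _ * unsentState a j false (k + 1) p.2.2)) = psi a (k + 1) _ * _
  rw [psi_succ, phi_comm]
  ring

theorem run_exchange (x y : Player) :
    run _ (exchange (opp := .bob) (by decide) (aliceFinish a) j k true)
        (exchange (opp := .alice) (by decide) (bobFinish a) j k false)
        (pureState (honestState a j k true false)) x y =
      (if x = y then winProb a x (k + j) else 0) ∧
    run _ (exchange (opp := .bob) (by decide) (aliceFinish a) j k false)
        (exchange (opp := .alice) (by decide) (bobFinish a) j k true)
        (pureState (honestState a j k false true)) x y =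
      if x = y then winProb a x (k + j) else 0 := by
  induction j generalizing k with
  | zero => exact ⟨run_exchange_zero a k true false x y, run_exchange_zero a k false true x y⟩
  | succ j ih =>
    rw [← add_assoc, add_right_comm]
    exact ⟨(run_exchange_alice_sends a j k x y).trans (ih (k + 1)).2,
      (run_exchange_bob_sends a j k x y).trans (ih (k + 1)).1⟩

theorem outcomeProb_protocol (n : ℕ) (x y : Player) :
    outcomeProb (protocol n a).alice (protocol n a).bob x y =
      if x = y then winProb a x n else 0 := by
  have h := (run_exchange a n 0 x y).1
  rw [zero_add] at h
  refine Eq.trans ?_ h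
  refine congrArg (fun σ => run _ _ _ σ x y) ?_
  ext p q
  change (unsentState a n true 0 _ * star (unsentState a n true 0 _)) *
    (unsentState a n false 0 _ * star (unsentState a n false 0 _)) =
    (∏ i : Fin 0, _) * (unsentState a n true 0 _ * unsentState a n false 0 _) *
      star ((∏ i : Fin 0, _) * (unsentState a n true 0 _ * unsentState a n false 0 _))
  simp only [Finset.univ_eq_empty, Finset.prod_empty, one_mul, star_mul']
  ring

theorem length_messagesFrom (p q : Player) (k j : ℕ) :
    (messagesFrom p q k j).length = j + 2 := by
  induction j generalizing p q k with
  | zero => rfl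
  | succ j ih => rw [messagesFrom, List.length_cons, ih]

theorem winProb_zero (w : Player) :
    winProb a w 0 = if w = .alice then 1 else 0 := by
  cases w <;> simp [winProb, stringProb, E, winner]

theorem E_snoc_zero (w : Player) (n : ℕ) (x : Fin n → Fin 2) :
    E w (n + 1) (Fin.snoc x 0) = if (sender (n + 1)).other = w then 1 else 0 := by
  simp [E, winner]

theorem E_snoc_one (w : Player) (n : ℕ) (x : Fin n → Fin 2) :
    E w (n + 1) (Fin.snoc x 1) = E w n x := by
  simp [E, winner]

theorem sum_stringProb (n : ℕ) : ∑ x, stringProb a n x = 1 := by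
  induction n with
  | zero => simp [stringProb]
  | succ n ih => simp only [sum_snoc, stringProb_snoc, ← Finset.mul_sum, sum_bitProb, mul_one, ih]

theorem winProb_succ (w : Player) (n : ℕ) :
    winProb a w (n + 1) = (if (sender (n + 1)).other = w then (a (n + 1) : ℝ) else 0) +
      (1 - a (n + 1)) * winProb a w n := by
  calc winProb a w (n + 1)
      = ∑ x, ((if (sender (n + 1)).other = w then (a (n + 1) : ℝ) else 0) * stringProb a n x +
          (1 - a (n + 1)) * (E w n x * stringProb a n x)) := by
        rw [winProb, sum_snoc]
        refine Finset.sum_congr rfl fun x _ => ?_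
        simp only [Fin.sum_univ_two, E_snoc_zero, E_snoc_one, stringProb_snoc, bitProb,
          Matrix.cons_val_zero, Matrix.cons_val_one]
        split_ifs <;> ring
    _ = _ := by
        rw [Finset.sum_add_distrib, ← Finset.mul_sum, ← Finset.mul_sum, sum_stringProb, mul_one,
          winProb]

theorem winProb_alice_add_bob (n : ℕ) :
    winProb a .alice n + winProb a .bob n = 1 := by
  rw [winProb, winProb, ← Finset.sum_add_distrib, ← sum_stringProb a n]
  refine Finset.sum_congr rfl fun x _ => ?_
  unfold E
  cases winner n x <;> simp

theorem achieves_of_winProb {n : ℕ} (h : winProb a .alice n = 1 / 2)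
    {ε δ : ℝ} (hε : |max (boundAlice n a) (boundBob n a) - 1 / 2 - ε| ≤ δ) :
    Achieves n a ε δ := by
  have h' : winProb a .bob n = 1 / 2 := by linarith [winProb_alice_add_bob a n]
  refine ⟨length_messagesFrom .alice .bob 0 n, fun x y => ?_, ?_, ?_, hε⟩
  · rw [outcomeProb_protocol]
    cases x <;> simp [h, h']
  · refine (cheatAlice_protocol_le n a).trans_eq ?_
    rw [h, boundAlice]
    norm_num
  · refine (cheatBob_protocol_le n a).trans_eq ?_
    rw [h', boundBob]
    norm_num

end HonestRun

theorem Achieves.bias_le {n : ℕ} {a : ℕ → unitInterval} {ε δ : ℝ} (h : Achieves n a ε δ) :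
    (protocol n a).bias ≤ ε + δ := by
  obtain ⟨-, -, hA, hB, hε⟩ := h
  have := (abs_le.1 hε).2
  have := max_le_max hA hB
  unfold Protocol.bias
  linarith

theorem Player.other_ne (p : Player) : p.other ≠ p := by
  cases p <;> decide

theorem Player.eq_or_eq_other (p q : Player) : p = q ∨ p = q.other := by
  cases p <;> cases q <;> decide

theorem other_sender_succ (n : ℕ) : (sender (n + 1)).other = sender n := by
  rw [sender_succ]
  cases sender n <;> rfl

theorem winner_snoc_zero (n : ℕ) (x : Fin n → Fin 2) :
    winner (n + 1) (Fin.snoc x 0) = sender n := by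
  simp [winner, other_sender_succ]

theorem winner_snoc_one (n : ℕ) (x : Fin n → Fin 2) :
    winner (n + 1) (Fin.snoc x 1) = winner n x := by
  simp [winner]

theorem traceLast_comp_winner (a : ℝ) (n : ℕ) (d : Player → ℝ) :
    traceLast a (d ∘ winner (n + 1)) =
      Function.update d (sender n).other
        (a * d (sender n) + (1 - a) * d (sender n).other) ∘ winner n := by
  ext x
  simp only [traceLast, Function.comp_apply, winner_snoc_zero, winner_snoc_one]
  obtain h | h := Player.eq_or_eq_other (winner n x) (sender n) <;> rw [h]
  · rw [Function.update_of_ne (Player.other_ne _).symm]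
    ring
  · rw [Function.update_self]

theorem rmsLast_comp_winner (a : ℝ) (n : ℕ) (d : Player → ℝ) (hd : 0 ≤ d (sender n)) :
    rmsLast a (d ∘ winner (n + 1)) =
      Function.update d (sender n).other
        (√(a * d (sender n) ^ 2 + (1 - a) * d (sender n).other ^ 2)) ∘ winner n := by
  ext x
  simp only [rmsLast, Function.comp_apply, winner_snoc_zero, winner_snoc_one]
  obtain h | h := Player.eq_or_eq_other (winner n x) (sender n) <;> rw [h]
  · rw [Function.update_of_ne (Player.other_ne _).symm, ← add_mul, add_sub_cancel, one_mul,
      Real.sqrt_sq hd]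
  · rw [Function.update_self]

section Certificates

open Set

/-- Interval arithmetic for `nested`: it takes a value in `K` on each diagonal matrix whose entries
depend only on the winner, being in `I` where the sender of qubit `n` wins and in `J` where the
other player wins. -/
def NestedMem (a : ℕ → unitInterval) (h : Player) (n : ℕ) (I J K : Set ℝ) : Prop :=
  ∀ d : Player → ℝ, d (sender n) ∈ I → d (sender n).other ∈ J → nested a h n (d ∘ winner n) ∈ K

namespace NestedMem

variable {a : ℕ → unitInterval} {h : Player} {n : ℕ} {u u' v v' x : ℝ} {K : Set ℝ}

theorem zero (I J : Set ℝ) : NestedMem a h 0 I J J := fun _ _ hJ => hJ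

theorem trace (lo hi : ℝ) (hs : sender (n + 1) = h) (hx : a (n + 1) = x)
    (bounds : lo ≤ x * v + (1 - x) * u ∧ x * v' + (1 - x) * u' ≤ hi)
    (next : NestedMem a h n (Icc v v') (Icc lo hi) K) :
    NestedMem a h (n + 1) (Icc u u') (Icc v v') K := by
  subst hx
  obtain ⟨hlo, hhi⟩ := bounds
  have h0 := (a (n + 1)).2.1
  have h1 := sub_nonneg.2 (a (n + 1)).2.2
  rintro d ⟨hu, hu'⟩ ⟨hv, hv'⟩
  rw [other_sender_succ] at hv hv'
  rw [sender_succ] at hu hu'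
  rw [nested, if_pos hs, traceLast_comp_winner]
  apply next
  · rw [Function.update_of_ne (Player.other_ne _).symm]
    exact ⟨hv, hv'⟩
  · rw [Function.update_self]
    exact ⟨hlo.trans (by gcongr), le_trans (by gcongr) hhi⟩

theorem rms (lo hi : ℝ) (hs : sender (n + 1) = h.other) (hx : a (n + 1) = x)
    (bounds : 0 ≤ u ∧ 0 ≤ v ∧ 0 ≤ hi ∧ lo ^ 2 ≤ x * v ^ 2 + (1 - x) * u ^ 2 ∧
      x * v' ^ 2 + (1 - x) * u' ^ 2 ≤ hi ^ 2)
    (next : NestedMem a h n (Icc v v') (Icc lo hi) K) :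
    NestedMem a h (n + 1) (Icc u u') (Icc v v') K := by
  subst hx
  obtain ⟨hu0, hv0, hhi0, hlo, hhi⟩ := bounds
  have h0 := (a (n + 1)).2.1
  have h1 := sub_nonneg.2 (a (n + 1)).2.2
  rintro d ⟨hu, hu'⟩ ⟨hv, hv'⟩
  rw [other_sender_succ] at hv hv'
  rw [sender_succ] at hu hu'
  have hd := hv0.trans hv
  have hd' := hu0.trans hu
  rw [nested, if_neg (hs ▸ Player.other_ne h), rmsLast_comp_winner _ _ _ hd]
  apply next
  · rw [Function.update_of_ne (Player.other_ne _).symm]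
    exact ⟨hv, hv'⟩
  · rw [Function.update_self]
    exact ⟨Real.le_sqrt_of_sq_le (hlo.trans (by gcongr)),
      Real.sqrt_le_iff.2 ⟨hhi0, le_trans (by gcongr) hhi⟩⟩

theorem nested_E_mem {w : Player} (cert : NestedMem a h n (Icc u u) (Icc v v) K)
    (hu : (if sender n = w then 1 else 0) = u) (hv : (if sender n = w then 0 else 1) = v) :
    nested a h n (E w n) ∈ K := by
  refine cert (fun p => if p = w then 1 else 0) (by rw [hu, Icc_self, mem_singleton_iff]) ?_
  suffices (if (sender n).other = w then 1 else 0) = v by rw [this, Icc_self, mem_singleton_iff]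
  rw [← hv]
  cases sender n <;> cases w <;> simp [Player.other]

end NestedMem

theorem abs_two_mul_sq_sub_le_of_mem_Icc {c δ L R y : ℝ} (hy : y ∈ Icc L R)
    (bounds : 0 ≤ L ∧ c - δ ≤ 2 * L ^ 2 ∧ 2 * R ^ 2 ≤ c + δ) : |2 * y ^ 2 - c| ≤ δ := by
  obtain ⟨hL, hlo, hhi⟩ := bounds
  obtain ⟨hLy, hyR⟩ := hy
  have hy0 := hL.trans hLy
  rw [abs_sub_le_iff, sub_le_iff_le_add', sub_le_comm]
  exact ⟨le_trans (by gcongr) hhi, hlo.trans (by gcongr)⟩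

theorem exists_params (l : List ℝ) (hl : ∀ x ∈ l, x ∈ Icc 0 1) :
    ∃ a : ℕ → unitInterval, ∀ (k : ℕ) (x : ℝ), l[k]? = some x → a (k + 1) = x := by
  refine ⟨fun k => if hk : k - 1 < l.length then ⟨l[k - 1], hl _ (l.getElem_mem hk)⟩ else 0, ?_⟩
  intro k x hx
  obtain ⟨hk, rfl⟩ := List.getElem?_eq_some_iff.1 hx
  simp [hk]

theorem achieves_of_abs_sub_le {n : ℕ} {a : ℕ → unitInterval} {c ε δ : ℝ}
    (fair : winProb a .alice n = 1 / 2) (hc : c = 1 / 2 + ε) (hα : |boundAlice n a - c| ≤ δ)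
    (hβ : |boundBob n a - c| ≤ δ) : Achieves n a ε δ := by
  have h := (abs_max_sub_max_le_max (boundAlice n a) (boundBob n a) c c).trans (max_le hα hβ)
  rw [max_self, hc, ← sub_sub] at h
  exact achieves_of_winProb a fair h

-- The parameters come from decimals `p 0 = 1`, …, `p n = 1 / 2`, where `p k` is the probability
-- that Alice wins with the first `k` qubits: `a k` is `1 - p k / p (k - 1)` for odd `k` and
-- `(p k - p (k - 1)) / (1 - p (k - 1))` for even `k`, so that fairness is exact. The two numbers in
-- each certificate line are rounded endpoints for the entry at the player who loses on qubit `k`.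
theorem exists_achieves_three : ∃ a : ℕ → unitInterval,
    |(a 1 : ℝ) - 0.74094| ≤ 1e-6 ∧ |(a 2 : ℝ) - 0.479696| ≤ 1e-6 ∧ |(a 3 : ℝ) - 0.186312| ≤ 1e-6 ∧
    Achieves 3 a 0.19905 5e-6 ∧ |boundAlice 3 a - 0.69905| ≤ 5e-6 ∧
    |boundBob 3 a - 0.69905| ≤ 5e-6 := by
  obtain ⟨a, ha⟩ := exists_params
    [1 - 0.25906, (0.614486 - 0.25906) / (1 - 0.25906), 1 - 0.5 / 0.614486]
    (by norm_num)
  obtain ⟨h1, h2, h3⟩ : (a 1 : ℝ) = _ ∧ (a 2 : ℝ) = _ ∧ (a 3 : ℝ) = _ :=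
    ⟨ha 0 _ rfl, ha 1 _ rfl, ha 2 _ rfl⟩
  have hα : |boundAlice 3 a - 0.69905| ≤ 5e-6 := abs_two_mul_sq_sub_le_of_mem_Icc
    (NestedMem.nested_E_mem (
      .rms 0.90204666 0.90204667 (by decide) h3 (by norm_num) <|
      .trace 0.43270823 0.43270824 (by decide) h2 (by norm_num) <|
      .rms 0.59120639 0.59120641 (by decide) h1 (by norm_num) <|
      .zero _ _) (if_pos (by decide)) (if_pos (by decide))) (by norm_num)
  have hβ : |boundBob 3 a - 0.69905| ≤ 5e-6 := abs_two_mul_sq_sub_le_of_mem_Icc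
    (NestedMem.nested_E_mem (
      .trace 0.18631181 0.18631182 (by decide) h3 (by norm_num) <|
      .rms 0.73277226 0.73277227 (by decide) h2 (by norm_num) <|
      .trace 0.59120621 0.59120623 (by decide) h1 (by norm_num) <|
      .zero _ _) (if_neg (by decide)) (if_neg (by decide))) (by norm_num)
  have fair : winProb a .alice 3 = 1 / 2 := by
    norm_num [winProb_succ, winProb_zero, sender, Player.other, show Player.bob ≠ .alice by decide,
      h1, h2, h3]
  refine ⟨a, ?_, ?_, ?_, achieves_of_abs_sub_le fair (by norm_num) hα hβ, hα, hβ⟩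
  all_goals norm_num [abs_le, h1, h2, h3]

theorem exists_achieves_eight : ∃ a : ℕ → unitInterval,
    |(a 1 : ℝ) - 0.680706| ≤ 1e-6 ∧ |(a 2 : ℝ) - 0.43281| ≤ 1e-6 ∧ |(a 3 : ℝ) - 0.323787| ≤ 1e-6 ∧
    |(a 4 : ℝ) - 0.264123| ≤ 1e-6 ∧ |(a 5 : ℝ) - 0.224377| ≤ 1e-6 ∧ |(a 6 : ℝ) - 0.197997| ≤ 1e-6 ∧
    |(a 7 : ℝ) - 0.177191| ≤ 1e-6 ∧ |(a 8 : ℝ) - 0.0834815| ≤ 1e-6 ∧ Achieves 8 a 0.1931 5e-5 := by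
  obtain ⟨a, ha⟩ := exists_params
    [1 - 0.3192941, (0.61391035 - 0.3192941) / (1 - 0.3192941), 1 - 0.4151341 / 0.61391035,
      (0.56961058 - 0.4151341) / (1 - 0.4151341), 1 - 0.44180301 / 0.56961058,
      (0.55232428 - 0.44180301) / (1 - 0.44180301), 1 - 0.45445733 / 0.55232428,
      (0.5 - 0.45445733) / (1 - 0.45445733)]
    (by norm_num)
  obtain ⟨h1, h2, h3, h4, h5, h6, h7, h8⟩ :
      (a 1 : ℝ) = _ ∧ (a 2 : ℝ) = _ ∧ (a 3 : ℝ) = _ ∧ (a 4 : ℝ) = _ ∧ (a 5 : ℝ) = _ ∧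
      (a 6 : ℝ) = _ ∧ (a 7 : ℝ) = _ ∧ (a 8 : ℝ) = _ :=
    ⟨ha 0 _ rfl, ha 1 _ rfl, ha 2 _ rfl, ha 3 _ rfl, ha 4 _ rfl, ha 5 _ rfl, ha 6 _ rfl, ha 7 _ rfl⟩
  have hα : |boundAlice 8 a - 0.6931| ≤ 5e-5 := abs_two_mul_sq_sub_le_of_mem_Icc
    (NestedMem.nested_E_mem (
      .trace 0.0834814 0.08348141 (by decide) h8 (by norm_num) <|
      .rms 0.90776856 0.90776857 (by decide) h7 (by norm_num) <|
      .trace 0.24668769 0.24668771 (by decide) h6 (by norm_num) <|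
      .rms 0.8079614 0.80796142 (by decide) h5 (by norm_num) <|
      .trace 0.39493293 0.39493296 (by decide) h4 (by norm_num) <|
      .rms 0.7013805 0.70138053 (by decide) h3 (by norm_num) <|
      .trace 0.52756647 0.52756651 (by decide) h2 (by norm_num) <|
      .rms 0.58866818 0.58866822 (by decide) h1 (by norm_num) <|
      .zero _ _) (if_neg (by decide)) (if_neg (by decide))) (by norm_num)
  have hβ : |boundBob 8 a - 0.6931| ≤ 5e-5 := abs_two_mul_sq_sub_le_of_mem_Icc
    (NestedMem.nested_E_mem (
      .rms 0.95734977 0.95734978 (by decide) h8 (by norm_num) <|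
      .trace 0.16963386 0.16963387 (by decide) h7 (by norm_num) <|
      .rms 0.86066732 0.86066734 (by decide) h6 (by norm_num) <|
      .trace 0.32468594 0.32468596 (by decide) h5 (by norm_num) <|
      .rms 0.75693047 0.7569305 (by decide) h4 (by norm_num) <|
      .trace 0.46464114 0.46464117 (by decide) h3 (by norm_num) <|
      .rms 0.6468446 0.64684464 (by decide) h2 (by norm_num) <|
      .trace 0.58866811 0.58866815 (by decide) h1 (by norm_num) <|
      .zero _ _) (if_pos (by decide)) (if_pos (by decide))) (by norm_num)
  have fair : winProb a .alice 8 = 1 / 2 := by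
    norm_num [winProb_succ, winProb_zero, sender, Player.other, show Player.bob ≠ .alice by decide,
      h1, h2, h3, h4, h5, h6, h7, h8]
  refine ⟨a, ?_, ?_, ?_, ?_, ?_, ?_, ?_, ?_, achieves_of_abs_sub_le fair (by norm_num) hα hβ⟩
  all_goals norm_num [abs_le, h1, h2, h3, h4, h5, h6, h7, h8]

theorem exists_achieves_four : ∃ a : ℕ → unitInterval, Achieves 4 a 0.1957 5e-5 := by
  obtain ⟨a, ha⟩ := exists_params
    [1 - 0.308055, (0.628336 - 0.308055) / (1 - 0.308055), 1 - 0.405597 / 0.628336,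
      (0.5 - 0.405597) / (1 - 0.405597)]
    (by norm_num)
  obtain ⟨h1, h2, h3, h4⟩ : (a 1 : ℝ) = _ ∧ (a 2 : ℝ) = _ ∧ (a 3 : ℝ) = _ ∧ (a 4 : ℝ) = _ :=
    ⟨ha 0 _ rfl, ha 1 _ rfl, ha 2 _ rfl, ha 3 _ rfl⟩
  have hα : |boundAlice 4 a - 0.6957| ≤ 5e-5 := abs_two_mul_sq_sub_le_of_mem_Icc
    (NestedMem.nested_E_mem (
      .trace 0.15881985 0.15881986 (by decide) h4 (by norm_num) <|
      .rms 0.80898164 0.80898165 (by decide) h3 (by norm_num) <|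
      .trace 0.45976063 0.45976065 (by decide) h2 (by norm_num) <|
      .rms 0.58980523 0.58980525 (by decide) h1 (by norm_num) <|
      .zero _ _) (if_neg (by decide)) (if_neg (by decide))) (by norm_num)
  have hβ : |boundBob 4 a - 0.6957| ≤ 5e-5 := abs_two_mul_sq_sub_le_of_mem_Icc
    (NestedMem.nested_E_mem (
      .rms 0.91715873 0.91715874 (by decide) h4 (by norm_num) <|
      .trace 0.32512384 0.32512386 (by decide) h3 (by norm_num) <|
      .rms 0.7076373 0.70763732 (by decide) h2 (by norm_num) <|
      .trace 0.58980211 0.58980214 (by decide) h1 (by norm_num) <|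
      .zero _ _) (if_pos (by decide)) (if_pos (by decide))) (by norm_num)
  have fair : winProb a .alice 4 = 1 / 2 := by
    norm_num [winProb_succ, winProb_zero, sender, Player.other, show Player.bob ≠ .alice by decide,
      h1, h2, h3, h4]
  exact ⟨a, achieves_of_abs_sub_le fair (by norm_num) hα hβ⟩

theorem exists_achieves_six : ∃ a : ℕ → unitInterval, Achieves 6 a 0.1937 5e-5 := by
  obtain ⟨a, ha⟩ := exists_params
    [1 - 0.315294, (0.618589 - 0.315294) / (1 - 0.315294), 1 - 0.41155 / 0.618589,
      (0.574305 - 0.41155) / (1 - 0.41155), 1 - 0.438591 / 0.574305,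
      (0.5 - 0.438591) / (1 - 0.438591)]
    (by norm_num)
  obtain ⟨h1, h2, h3, h4, h5, h6⟩ :
      (a 1 : ℝ) = _ ∧ (a 2 : ℝ) = _ ∧ (a 3 : ℝ) = _ ∧ (a 4 : ℝ) = _ ∧ (a 5 : ℝ) = _ ∧
      (a 6 : ℝ) = _ :=
    ⟨ha 0 _ rfl, ha 1 _ rfl, ha 2 _ rfl, ha 3 _ rfl, ha 4 _ rfl, ha 5 _ rfl⟩
  have hα : |boundAlice 6 a - 0.6937| ≤ 5e-5 := abs_two_mul_sq_sub_le_of_mem_Icc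
    (NestedMem.nested_E_mem (
      .trace 0.10938371 0.10938372 (by decide) h6 (by norm_num) <|
      .rms 0.8755098 0.87550981 (by decide) h5 (by norm_num) <|
      .trace 0.32128081 0.32128083 (by decide) h4 (by norm_num) <|
      .rms 0.7379127 0.73791272 (by decide) h3 (by norm_num) <|
      .trace 0.50583063 0.50583066 (by decide) h2 (by norm_num) <|
      .rms 0.58896044 0.58896048 (by decide) h1 (by norm_num) <|
      .zero _ _) (if_neg (by decide)) (if_neg (by decide))) (by norm_num)
  have hβ : |boundBob 6 a - 0.6937| ≤ 5e-5 := abs_two_mul_sq_sub_le_of_mem_Icc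
    (NestedMem.nested_E_mem (
      .rms 0.94372468 0.94372469 (by decide) h6 (by norm_num) <|
      .trace 0.22301155 0.22301156 (by decide) h5 (by norm_num) <|
      .rms 0.81119846 0.81119848 (by decide) h4 (by norm_num) <|
      .trace 0.4198751 0.41987512 (by decide) h3 (by norm_num) <|
      .rms 0.6668205 0.66682053 (by decide) h2 (by norm_num) <|
      .trace 0.58896009 0.58896013 (by decide) h1 (by norm_num) <|
      .zero _ _) (if_pos (by decide)) (if_pos (by decide))) (by norm_num)
  have fair : winProb a .alice 6 = 1 / 2 := by
    norm_num [winProb_succ, winProb_zero, sender, Player.other, show Player.bob ≠ .alice by decide,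
      h1, h2, h3, h4, h5, h6]
  exact ⟨a, achieves_of_abs_sub_le fair (by norm_num) hα hβ⟩

theorem exists_achieves_ten : ∃ a : ℕ → unitInterval, Achieves 10 a 0.1927 5e-5 := by
  obtain ⟨a, ha⟩ := exists_params
    [1 - 0.321909, (0.611115 - 0.321909) / (1 - 0.321909), 1 - 0.417489 / 0.611115,
      (0.566833 - 0.417489) / (1 - 0.417489), 1 - 0.443944 / 0.566833,
      (0.549595 - 0.443944) / (1 - 0.443944), 1 - 0.45646 / 0.549595,
      (0.540372 - 0.45646) / (1 - 0.45646), 1 - 0.463801 / 0.540372,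
      (0.5 - 0.463801) / (1 - 0.463801)]
    (by norm_num)
  obtain ⟨h1, h2, h3, h4, h5, h6, h7, h8, h9, h10⟩ :
      (a 1 : ℝ) = _ ∧ (a 2 : ℝ) = _ ∧ (a 3 : ℝ) = _ ∧ (a 4 : ℝ) = _ ∧ (a 5 : ℝ) = _ ∧
      (a 6 : ℝ) = _ ∧ (a 7 : ℝ) = _ ∧ (a 8 : ℝ) = _ ∧ (a 9 : ℝ) = _ ∧ (a 10 : ℝ) = _ :=
    ⟨ha 0 _ rfl, ha 1 _ rfl, ha 2 _ rfl, ha 3 _ rfl, ha 4 _ rfl, ha 5 _ rfl, ha 6 _ rfl,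
     ha 7 _ rfl, ha 8 _ rfl, ha 9 _ rfl⟩
  have hα : |boundAlice 10 a - 0.6927| ≤ 5e-5 := abs_two_mul_sq_sub_le_of_mem_Icc
    (NestedMem.nested_E_mem (
      .trace 0.06751038 0.06751039 (by decide) h10 (by norm_num) <|
      .rms 0.92679301 0.92679302 (by decide) h9 (by norm_num) <|
      .trace 0.20016689 0.20016691 (by decide) h8 (by norm_num) <|
      .rms 0.84863254 0.84863256 (by decide) h7 (by norm_num) <|
      .trace 0.32337578 0.32337581 (by decide) h6 (by norm_num) <|
      .rms 0.76597283 0.76597286 (by decide) h5 (by norm_num) <|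
      .trace 0.43684868 0.43684872 (by decide) h4 (by norm_num) <|
      .rms 0.67917914 0.67917918 (by decide) h3 (by norm_num) <|
      .trace 0.54020268 0.54020273 (by decide) h2 (by norm_num) <|
      .rms 0.58853323 0.58853328 (by decide) h1 (by norm_num) <|
      .zero _ _) (if_neg (by decide)) (if_neg (by decide))) (by norm_num)
  have hβ : |boundBob 10 a - 0.6927| ≤ 5e-5 := abs_two_mul_sq_sub_le_of_mem_Icc
    (NestedMem.nested_E_mem (
      .rms 0.96565501 0.96565502 (by decide) h10 (by norm_num) <|
      .trace 0.13683382 0.13683384 (by decide) h9 (by norm_num) <|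
      .rms 0.88961895 0.88961897 (by decide) h8 (by norm_num) <|
      .trace 0.26440165 0.26440168 (by decide) h7 (by norm_num) <|
      .rms 0.80890902 0.80890905 (by decide) h6 (by norm_num) <|
      .trace 0.38245046 0.3824505 (by decide) h5 (by norm_num) <|
      .rms 0.72393102 0.72393106 (by decide) h4 (by norm_num) <|
      .trace 0.49064534 0.49064539 (by decide) h3 (by norm_num) <|
      .rms 0.63500404 0.63500409 (by decide) h2 (by norm_num) <|
      .trace 0.58853367 0.58853373 (by decide) h1 (by norm_num) <|
      .zero _ _) (if_pos (by decide)) (if_pos (by decide))) (by norm_num)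
  have fair : winProb a .alice 10 = 1 / 2 := by
    norm_num [winProb_succ, winProb_zero, sender, Player.other, show Player.bob ≠ .alice by decide,
      h1, h2, h3, h4, h5, h6, h7, h8, h9, h10]
  exact ⟨a, achieves_of_abs_sub_le fair (by norm_num) hα hβ⟩

end Certificates

theorem Achieves.bias_lt {n : ℕ} {a : ℕ → unitInterval} {ε δ : ℝ} (h : Achieves n a ε δ)
    (hε : ε + δ < 1 / 5) : (protocol n a).bias < 1 / √2 - 1 / 2 := by
  have h2 : (7 / 10 : ℝ) < 1 / √2 := by
    rw [lt_div_iff₀ (by positivity), ← lt_div_iff₀' (by norm_num), Real.sqrt_lt' (by norm_num)]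
    norm_num
  linarith [h.bias_le]

end CoinFlip

end

theorem mainTheorem2 :
    -- protocols with a bias strictly below that of Spekkens and Rudolph exist
    (∃ P : CoinFlip.Protocol, P.IsFair ∧ P.bias < 1 / √2 - 1 / 2) ∧
    -- n = 3
    (∃ a : ℕ → unitInterval,
      |(a 1 : ℝ) - 0.74094| ≤ 1e-6 ∧ |(a 2 : ℝ) - 0.479696| ≤ 1e-6 ∧
      |(a 3 : ℝ) - 0.186312| ≤ 1e-6 ∧
      CoinFlip.Achieves 3 a 0.19905 5e-6 ∧
      |CoinFlip.boundAlice 3 a - 0.69905| ≤ 5e-6 ∧ |CoinFlip.boundBob 3 a - 0.69905| ≤ 5e-6 ∧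
      (CoinFlip.protocol 3 a).bias ≤ 0.1991) ∧
    -- n = 8
    (∃ a : ℕ → unitInterval,
      |(a 1 : ℝ) - 0.680706| ≤ 1e-6 ∧ |(a 2 : ℝ) - 0.43281| ≤ 1e-6 ∧
      |(a 3 : ℝ) - 0.323787| ≤ 1e-6 ∧ |(a 4 : ℝ) - 0.264123| ≤ 1e-6 ∧
      |(a 5 : ℝ) - 0.224377| ≤ 1e-6 ∧ |(a 6 : ℝ) - 0.197997| ≤ 1e-6 ∧
      |(a 7 : ℝ) - 0.177191| ≤ 1e-6 ∧ |(a 8 : ℝ) - 0.0834815| ≤ 1e-6 ∧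
      CoinFlip.Achieves 8 a 0.1931 5e-5 ∧ (CoinFlip.protocol 8 a).bias ≤ 0.19315) ∧
    -- n = 4, 6, 10
    (∃ a : ℕ → unitInterval,
      CoinFlip.Achieves 4 a 0.1957 5e-5 ∧ (CoinFlip.protocol 4 a).bias ≤ 0.19575) ∧
    (∃ a : ℕ → unitInterval,
      CoinFlip.Achieves 6 a 0.1937 5e-5 ∧ (CoinFlip.protocol 6 a).bias ≤ 0.19375) ∧
    (∃ a : ℕ → unitInterval,
      CoinFlip.Achieves 10 a 0.1927 5e-5 ∧ (CoinFlip.protocol 10 a).bias ≤ 0.19275) := by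
  obtain ⟨a, h1, h2, h3, hA, hα, hβ⟩ := CoinFlip.exists_achieves_three
  obtain ⟨b, g1, g2, g3, g4, g5, g6, g7, g8, hB⟩ := CoinFlip.exists_achieves_eight
  obtain ⟨a₄, h₄⟩ := CoinFlip.exists_achieves_four
  obtain ⟨a₆, h₆⟩ := CoinFlip.exists_achieves_six
  obtain ⟨a₁₀, h₁₀⟩ := CoinFlip.exists_achieves_ten
  refine ⟨⟨_, hA.2.1, hA.bias_lt (by norm_num)⟩,
    ⟨a, h1, h2, h3, hA, hα, hβ, hA.bias_le.trans (by norm_num)⟩,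
    ⟨b, g1, g2, g3, g4, g5, g6, g7, g8, hB, hB.bias_le.trans (by norm_num)⟩,
    ⟨a₄, h₄, h₄.bias_le.trans (by norm_num)⟩, ⟨a₆, h₆, h₆.bias_le.trans (by norm_num)⟩,
    ⟨a₁₀, h₁₀, h₁₀.bias_le.trans (by norm_num)⟩⟩
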